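/- Let $(M,\omega)$ be a compact symplectic manifold without boundary, $\dim M=2n$, with an almost complex structure $J$ and a Riemannian metric $g$ related by $g(X,Y)=\omega(X,JY)$, and let $\nabla$ be a connection on $TM$ with $\nabla g=0$ and $\nabla J=0$ (hence $\nabla\omega=0$; torsion is allowed). Fix a metaplectic structure on $M$, that is, a principal $Mp(2n,\mathbb R)$-bundle $P\to M$ with a morphism to the bundle of symplectic frames, equivariant with respect to the double covering $Mp(2n,\mathbb R)\to Sp(2n,\mathbb R)$. Let $\mathbf Q=P\times_{Mp(2n,\mathbb R)}L^2(\mathbb R^n)$ be the symplectic spinor bundle, associated with $P$ through the metaplectic representation, with its fiber norm $\|\cdot\|_x$, with the symplectic Clifford multiplication (in which the members $\mathsf e_j$, $\mathsf f_j$ of a symplectic frame act as $i\xi_j$ and $\partial/\partial\xi_j$, so that $X\cdot Y\cdot\varphi-Y\cdot X\cdot\varphi=-i\,\omega(X,Y)\varphi$) and with the covariant derivative $\nabla$ induced by the connection. Let $\mathbf Q^J_0\subset\mathbf Q$ be the subbundle on which $\mathcal H^J=\tfrac12\sum_{k=1}^{2n}u_k\cdot u_k\cdot$ equals $-\tfrac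 n2$, and let $$\widetilde{\mathcal D}\varphi=\sum_{k=1}^{2n}u_k\cdot\nabla_{u_k}\varphi ,$$ where $(u_1,\dots,u_{2n})$ is any unitary frame. Let $\varphi_0$ be a smooth section of $\mathbf Q^J_0$ (assumed to exist) with $\|\varphi_0\|_x^2=2$ for all $x\in M$. For a function $a$ put $[\widetilde{\mathcal D},a]\varphi_0=\widetilde{\mathcal D}(a\varphi_0)-a\,\widetilde{\mathcal D}\varphi_0$. Then, for every differentiable function $a:M\to\mathbb R$ and every $p\in M$, $$\|[\widetilde{\mathcal D},a]\varphi_0\|_p^2=g^{-1}(da,da)_p .$$ Moreover, let $\mathcal C\subset C(M)$ be any set of everywhere differentiable real functions that contains all smooth ones. Then, for all $x,y\in M$, $$\sup\bigl\{\,|a(x)-a(y)| \;:\; a\in\mathcal C,\ \|[\widetilde{\mathcal D},a]\varphi_0\|_p\le 1\ \text{ for all } p\in M\,\bigr\}$$ is the geodesic distance between $x$ and $y$, i.e. the infimum of the lengths of $C^1$ paths from $x$ to $y$ (equal to $+\infty$ if $x$ and $y$ lie in different components of $M$). -/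

import Mathlib

open Bundle Manifold MeasureTheory
open scoped Manifold ContDiff SchwartzMap RightActions ENNReal Topology

noncomputable section

namespace SymplecticSpinor

/-! ### The metaplectic representation -/

/-- The Schwartz space `𝓢(ℝⁿ) ⊆ L²(ℝⁿ)`, the space of smooth vectors of the metaplectic
representation and the common domain of the symplectic Clifford multiplications. -/
abbrev Schw (n : ℕ) : Type := 𝓢(EuclideanSpace ℝ (Fin n), ℂ)

/-- The norm of `L²(ℝⁿ)`. -/
def l2norm {n : ℕ} (f : Schw n) : ℝ := ‖f.toLp 2‖

/-- Symplectic Clifford multiplication by the standard symplectic basis `(e₁,…,eₙ,f₁,…,fₙ)` of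
`ℝ²ⁿ`: `e_j` acts as multiplication by `i ξ_j`, and `f_j` acts as `∂ / ∂ξ_j`. -/
def gen {n : ℕ} : Fin n ⊕ Fin n → (Schw n →L[ℂ] Schw n)
  | Sum.inl j => Complex.I •
      SchwartzMap.smulLeftCLM ℂ (fun ξ : EuclideanSpace ℝ (Fin n) => (ξ j : ℂ))
  | Sum.inr j => LineDeriv.lineDerivOpCLM ℂ (Schw n) (EuclideanSpace.single j (1 : ℝ))

theorem gen_inl_apply {n : ℕ} (j : Fin n) (f : Schw n) (ξ : EuclideanSpace ℝ (Fin n)) :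
    gen (Sum.inl j) f ξ = Complex.I * (ξ j : ℂ) * f ξ := by
  have h : (fun ξ : EuclideanSpace ℝ (Fin n) => (ξ j : ℂ)).HasTemperateGrowth :=
    (Complex.ofRealCLM ∘L (EuclideanSpace.proj j : EuclideanSpace ℝ (Fin n) →L[ℝ] ℝ)
      ).hasTemperateGrowth
  simp [gen, SchwartzMap.smulLeftCLM_apply_apply h, mul_assoc]

theorem gen_inr_apply {n : ℕ} (j : Fin n) (f : Schw n) (ξ : EuclideanSpace ℝ (Fin n)) :
    gen (Sum.inr j) f ξ = fderiv ℝ f ξ (EuclideanSpace.single j 1) := rfl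

/-- The standard generators of the metaplectic group: the chirps
`f ↦ exp (i ⟨Bξ, ξ⟩ / 2) f(ξ)` with `B` symmetric, the changes of variables
`f ↦ √(det L) f(Lξ)` with `L` invertible and either square root, and the Fourier transform
`f ↦ (2πi)^(-n/2) ∫ exp (-i⟨ξ, η⟩) f(η) dη`, again with either square root. -/
def IsMetaplecticGenerator {n : ℕ} (U : Schw n ≃L[ℂ] Schw n) : Prop :=
  (∃ B : Matrix (Fin n) (Fin n) ℝ, B.IsSymm ∧ ∀ f ξ,
    U f ξ = Complex.exp (Complex.I / 2 * ((∑ i, ∑ j, B i j * ξ i * ξ j : ℝ) : ℂ)) * f ξ) ∨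
  (∃ (L : Matrix (Fin n) (Fin n) ℝ) (c : ℂ), L.det ≠ 0 ∧ c ^ 2 = (L.det : ℂ) ∧ ∀ f ξ,
    U f ξ = c * f (WithLp.toLp 2 (L.mulVec ξ))) ∨
  (∃ c : ℂ, c ^ 2 = ((2 * Real.pi * Complex.I)⁻¹) ^ n ∧ ∀ f ξ,
    U f ξ = c * ∫ η, Complex.exp (-Complex.I * ((∑ i, ξ i * η i : ℝ) : ℂ)) * f η)

/-- The metaplectic group `Mp(2n, ℝ)`, realised through its (faithful) metaplectic
representation, restricted to the invariant dense subspace `𝓢(ℝⁿ)` of `L²(ℝⁿ)`. -/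
def metaplecticSubgroup (n : ℕ) : Subgroup (Schw n ≃L[ℂ] Schw n) :=
  Subgroup.closure {U | IsMetaplecticGenerator U}

/-- The metaplectic group as a type. -/
def Mp (n : ℕ) : Type := metaplecticSubgroup n

instance (n : ℕ) : Group (Mp n) := inferInstanceAs (Group (metaplecticSubgroup n))

/-- The metaplectic representation on Schwartz functions. -/
def Mp.rep {n : ℕ} (g : Mp n) : Schw n ≃L[ℂ] Schw n := Subtype.val g

/-- The topology of pointwise convergence of operators; it is the Lie group topology. -/
instance (n : ℕ) : TopologicalSpace (Mp n) :=
  TopologicalSpace.induced (fun g (f : Schw n) => g.rep f) inferInstance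

/-- `g.Covers S` says that `S` is the image of `g` under the double covering
`Mp(2n, ℝ) → Sp(2n, ℝ)`: the matrix `S` is determined by `g v g⁻¹ = S v` for all `v ∈ ℝ²ⁿ`, where
vectors act by Clifford multiplication. It is symplectic because conjugation preserves
commutators. -/
def Mp.Covers {n : ℕ} (g : Mp n) (S : Matrix (Fin n ⊕ Fin n) (Fin n ⊕ Fin n) ℝ) : Prop :=
  ∀ k f, g.rep (gen k f) = ∑ l, (S l k : ℂ) • gen l (g.rep f)

/-! ### Almost hermitian manifolds -/

section

variable {E : Type*} [NormedAddCommGroup E] [NormedSpace ℝ E]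
  {M : Type*} [TopologicalSpace M] [ChartedSpace E M] [IsManifold 𝓘(ℝ, E) ∞ M]

/-- Smooth vector fields. -/
def IsSmoothField (X : ∀ x : M, TangentSpace 𝓘(ℝ, E) x) : Prop :=
  ContMDiff 𝓘(ℝ, E) 𝓘(ℝ, E).tangent ∞ (fun x => (⟨x, X x⟩ : TangentBundle 𝓘(ℝ, E) M))

/-- The exterior derivative of a 2-form vanishes. -/
def IsClosedForm
    (form : ∀ x : M, TangentSpace 𝓘(ℝ, E) x →L[ℝ] TangentSpace 𝓘(ℝ, E) x →L[ℝ] ℝ) : Prop :=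
  ∀ X Y Z : (∀ x : M, TangentSpace 𝓘(ℝ, E) x),
    IsSmoothField X → IsSmoothField Y → IsSmoothField Z → ∀ x,
      mvfderiv 𝓘(ℝ, E) (fun y => form y (Y y) (Z y)) x (X x)
      - mvfderiv 𝓘(ℝ, E) (fun y => form y (X y) (Z y)) x (Y x)
      + mvfderiv 𝓘(ℝ, E) (fun y => form y (X y) (Y y)) x (Z x)
      - form x (VectorField.mlieBracket 𝓘(ℝ, E) X Y x) (Z x)
      + form x (VectorField.mlieBracket 𝓘(ℝ, E) X Z x) (Y x)
      - form x (VectorField.mlieBracket 𝓘(ℝ, E) Y Z x) (X x) = 0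

variable (E M) in
/-- A symplectic form `ω = form` and an almost complex structure `J` on a Riemannian manifold `(M, g)`,
related to the metric by `g(X, Y) = ω(X, JY)`. Nondegeneracy of `ω` follows from this relation. -/
structure AlmostHermitian [RiemannianBundle (fun x : M => TangentSpace 𝓘(ℝ, E) x)] where
  form : ∀ x : M, TangentSpace 𝓘(ℝ, E) x →L[ℝ] TangentSpace 𝓘(ℝ, E) x →L[ℝ] ℝ
  J : ∀ x : M, TangentSpace 𝓘(ℝ, E) x →L[ℝ] TangentSpace 𝓘(ℝ, E) x
  form_smooth : ContMDiff 𝓘(ℝ, E) (𝓘(ℝ, E).prod 𝓘(ℝ, E →L[ℝ] E →L[ℝ] ℝ)) ∞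
    (fun x => TotalSpace.mk' (E →L[ℝ] E →L[ℝ] ℝ) x (form x))
  J_smooth : ContMDiff 𝓘(ℝ, E) (𝓘(ℝ, E).prod 𝓘(ℝ, E →L[ℝ] E)) ∞
    (fun x => TotalSpace.mk' (E →L[ℝ] E) x (J x))
  form_self : ∀ x X, form x X X = 0
  form_closed : IsClosedForm form
  J_sq : ∀ x X, J x (J x X) = -X
  metric_eq : ∀ x (X Y : TangentSpace 𝓘(ℝ, E) x), inner ℝ X Y = form x X (J x Y)

namespace AlmostHermitian

variable [RiemannianBundle (fun x : M => TangentSpace 𝓘(ℝ, E) x)]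

/-- The frame `(e₁,…,eₙ,f₁,…,fₙ)` of `T_xM` is symplectic: `ω(e_i, f_j) = δ_ij` and
`ω(e_i, e_j) = ω(f_i, f_j) = 0`. -/
def IsSymplecticFrame {n : ℕ} (A : AlmostHermitian E M) {x : M}
    (b : Fin n ⊕ Fin n → TangentSpace 𝓘(ℝ, E) x) : Prop :=
  (∀ i j, A.form x (b (Sum.inl i)) (b (Sum.inr j)) = if i = j then 1 else 0) ∧
  (∀ i j, A.form x (b (Sum.inl i)) (b (Sum.inl j)) = 0) ∧
  (∀ i j, A.form x (b (Sum.inr i)) (b (Sum.inr j)) = 0)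

/-- The frame `(e₁,…,eₙ,f₁,…,fₙ)` of `T_xM` is unitary: it is orthonormal and symplectic,
and `J e_j = f_j`, `J f_j = -e_j`. -/
structure IsUnitaryFrame {n : ℕ} (A : AlmostHermitian E M) {x : M}
    (b : Fin n ⊕ Fin n → TangentSpace 𝓘(ℝ, E) x) : Prop where
  orthonormal : Orthonormal ℝ b
  symplectic : A.IsSymplecticFrame b
  J_inl : ∀ j, A.J x (b (Sum.inl j)) = b (Sum.inr j)
  J_inr : ∀ j, A.J x (b (Sum.inr j)) = -b (Sum.inl j)

/-- A hermitian symplectic connection: a smooth connection with `∇g = 0` and `∇J = 0`. Since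
`ω(X, Y) = g(JX, Y)`, this gives `∇ω = 0`. -/
structure IsHermitianConnection
    (A : AlmostHermitian E M)
    (cov : CovariantDerivative 𝓘(ℝ, E) E (fun x : M => TangentSpace 𝓘(ℝ, E) x)) : Prop where
  smooth : CovariantDerivative.ContMDiffCovariantDerivative cov ∞
  metric : ∀ (Y Z : ∀ x : M, TangentSpace 𝓘(ℝ, E) x), IsSmoothField Y → IsSmoothField Z →
    ∀ (x : M) (X : TangentSpace 𝓘(ℝ, E) x),
      mvfderiv 𝓘(ℝ, E) (fun y => (inner ℝ (Y y) (Z y) : ℝ)) x X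
        = inner ℝ (cov Y x X) (Z x) + inner ℝ (Y x) (cov Z x X)
  parallel_J : ∀ (Y : ∀ x : M, TangentSpace 𝓘(ℝ, E) x), IsSmoothField Y →
    ∀ (x : M) (X : TangentSpace 𝓘(ℝ, E) x),
      cov (fun y => A.J y (Y y)) x X = A.J x (cov Y x X)

end AlmostHermitian

/-! ### Metaplectic structures -/

variable [RiemannianBundle (fun x : M => TangentSpace 𝓘(ℝ, E) x)]

/-- A continuous map from a space `P` to the bundle of symplectic frames of `M`. -/
structure FrameMap (n : ℕ) (A : AlmostHermitian E M) (P : Type*) [TopologicalSpace P] where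
  proj : P → M
  proj_continuous : Continuous proj
  frame : ∀ p : P, Fin n ⊕ Fin n → TangentSpace 𝓘(ℝ, E) (proj p)
  frame_symplectic : ∀ p, A.IsSymplecticFrame (frame p)
  frame_continuous : ∀ k,
    Continuous (fun p => (⟨proj p, frame p k⟩ : TangentBundle 𝓘(ℝ, E) M))

/-- A smooth local section of `P` through the point `p`, defined on `U`: a continuous local
section which lifts a smooth local symplectic frame `e` of `M`. (As `P` covers the bundle of
symplectic frames, these are the smooth local sections of `P`.) -/
structure FrameMap.LocalSection {n : ℕ} {A : AlmostHermitian E M} {P : Type*} [TopologicalSpace P]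
    (F : FrameMap n A P) (p : P) where
  U : Set M
  isOpen : IsOpen U
  mem : F.proj p ∈ U
  toFun : M → P
  continuousOn : ContinuousOn toFun U
  proj_toFun : ∀ y ∈ U, F.proj (toFun y) = y
  toFun_proj : toFun (F.proj p) = p
  e : Fin n ⊕ Fin n → ∀ y : M, TangentSpace 𝓘(ℝ, E) y
  frame_toFun : ∀ y ∈ U, ∀ k,
    (⟨F.proj (toFun y), F.frame (toFun y) k⟩ : TangentBundle 𝓘(ℝ, E) M) = ⟨y, e k y⟩
  smooth : ∀ k, ContMDiffOn 𝓘(ℝ, E) 𝓘(ℝ, E).tangent ∞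
    (fun y => (⟨y, e k y⟩ : TangentBundle 𝓘(ℝ, E) M)) U

/-- A metaplectic structure: a (smoothly) locally trivial principal `Mp(2n, ℝ)`-bundle `P → M` with
a morphism to the bundle of symplectic frames which is equivariant with respect to
`Mp(2n, ℝ) → Sp(2n, ℝ)`. -/
structure MetaplecticStructure (n : ℕ) (A : AlmostHermitian E M) (P : Type*) [TopologicalSpace P]
    [MulAction (Mp n)ᵐᵒᵖ P] extends FrameMap n A P where
  proj_surjective : Function.Surjective proj
  continuous_act : Continuous (fun q : P × Mp n => q.1 <• q.2)
  proj_act : ∀ (p : P) (g : Mp n), proj (p <• g) = proj p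
  frame_act : ∀ (p : P) (g : Mp n) (S : Matrix (Fin n ⊕ Fin n) (Fin n ⊕ Fin n) ℝ), g.Covers S →
    ∀ k, (⟨proj (p <• g), frame (p <• g) k⟩ : TangentBundle 𝓘(ℝ, E) M) =
      ⟨proj p, ∑ l, S l k • frame p l⟩
  locally_trivial : ∀ p : P, ∃ s : toFrameMap.LocalSection p,
    ∃ Φ : (s.U × Mp n) ≃ₜ (proj ⁻¹' s.U), ∀ y g, (Φ (y, g) : P) = s.toFun y <• g

/-! ### Symplectic spinors -/

/-- The derivative at `x` of a map from `M` to the Fréchet space `𝓢(ℝⁿ)`. -/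
def schwDeriv {n : ℕ} (u : M → Schw n) (x : M) : TangentSpace 𝓘(ℝ, E) x →L[ℝ] Schw n :=
  fderiv ℝ (u ∘ (extChartAt 𝓘(ℝ, E) x).symm) (extChartAt 𝓘(ℝ, E) x x)

variable (E) in
/-- Maps from an open set `U ⊆ M` to the Fréchet space `𝓢(ℝⁿ)` of class `C^k`. -/
def SchwCk {n : ℕ} : ℕ → (M → Schw n) → Set M → Prop
  | 0, u, U => ContinuousOn u U
  | k + 1, u, U => ContinuousOn u U ∧
      (∀ x ∈ U, DifferentiableAt ℝ (u ∘ (extChartAt 𝓘(ℝ, E) x).symm) (extChartAt 𝓘(ℝ, E) x x)) ∧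
      ∀ X : (∀ x : M, TangentSpace 𝓘(ℝ, E) x), IsSmoothField X →
        SchwCk k (fun x => schwDeriv u x (X x)) U

namespace MetaplecticStructure

variable {n : ℕ} {A : AlmostHermitian E M} {P : Type*} [TopologicalSpace P]
  [MulAction (Mp n)ᵐᵒᵖ P] (S : MetaplecticStructure n A P)

/-- A smooth section of the symplectic spinor bundle `Q = P ×_{Mp} L²(ℝⁿ)`: an equivariant map
`φ : P → 𝓢(ℝⁿ)` which is smooth along smooth local sections of `P`. The value of the section at
`x ∈ M` is the class `[p, φ(p)]` for any `p` over `x`. -/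
structure IsSpinor (φ : P → Schw n) : Prop where
  equivariant : ∀ (p : P) (g : Mp n), φ (p <• g) = (g⁻¹).rep (φ p)
  smooth : ∀ (p : P) (s : S.LocalSection p) (k : ℕ), SchwCk E k (fun y => φ (s.toFun y)) s.U

/-- Symplectic Clifford multiplication `[p, f] ↦ [p, X · f]` by a tangent vector `X`, which has the
coordinates `ω(X, f_j)`, `ω(e_j, X)` in the symplectic frame `(e, f)` below `p`. -/
def clifford (p : P) (X : TangentSpace 𝓘(ℝ, E) (S.proj p)) : Schw n →L[ℂ] Schw n :=
  ∑ j : Fin n,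
    ((A.form (S.proj p) X (S.frame p (Sum.inr j)) : ℂ) • gen (Sum.inl j)
      + (A.form (S.proj p) (S.frame p (Sum.inl j)) X : ℂ) • gen (Sum.inr j))

/-- `φ` is a section of `Q_l^J`, the eigenbundle of `H^J = (1/2) ∑ u_k · u_k ·` (where `u` is any
unitary frame) for the eigenvalue `-(l + n/2)`. -/
def IsInQ (l : ℕ) (φ : P → Schw n) : Prop :=
  ∀ (p : P) (u : Fin n ⊕ Fin n → TangentSpace 𝓘(ℝ, E) (S.proj p)), A.IsUnitaryFrame u →
    (1 / 2 : ℂ) • ∑ k, S.clifford p (u k) (S.clifford p (u k) (φ p))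
      = (-((l : ℂ) + (n : ℂ) / 2)) • φ p

/-- The spinor covariant derivative at `p`, in the direction `X`, computed in the smooth local
section `s` of `P` lifting the local symplectic frame `(e, f)`:
`∇_X φ = X(φ) - (i/2) ∑_j (∇_X e_j · f_j · φ - ∇_X f_j · e_j · φ)`. -/
def covDeriv (cov : CovariantDerivative 𝓘(ℝ, E) E (fun x : M => TangentSpace 𝓘(ℝ, E) x))
    (φ : P → Schw n) {p : P} (s : S.LocalSection p)
    (X : TangentSpace 𝓘(ℝ, E) (S.proj p)) : Schw n :=
  schwDeriv (fun y => φ (s.toFun y)) (S.proj p) X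
    - (Complex.I / 2) • ∑ j : Fin n,
      (S.clifford p (cov (s.e (Sum.inl j)) (S.proj p) X)
          (S.clifford p (S.frame p (Sum.inr j)) (φ p))
        - S.clifford p (cov (s.e (Sum.inr j)) (S.proj p) X)
          (S.clifford p (S.frame p (Sum.inl j)) (φ p)))

/-- The Dirac operator `D̃ φ = ∑_k u_k · ∇_{u_k} φ`, computed at each `p` with the local section `κ p`
through `p` and the unitary frame `u` at the point below `p`. On spinors the result depends neither
on `κ` nor on `u`, and no continuity of `κ` or `u` in the base point is needed. -/
def dirac (cov : CovariantDerivative 𝓘(ℝ, E) E (fun x : M => TangentSpace 𝓘(ℝ, E) x))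
    (κ : ∀ p : P, S.LocalSection p) (u : ∀ x : M, Fin n ⊕ Fin n → TangentSpace 𝓘(ℝ, E) x)
    (φ : P → Schw n) (p : P) : Schw n :=
  ∑ k, S.clifford p (u (S.proj p) k) (S.covDeriv cov φ (κ p) (u (S.proj p) k))

/-- Multiplication of spinors by real functions on `M`. -/
def mulFun (a : M → ℝ) (φ : P → Schw n) (p : P) : Schw n := (a (S.proj p) : ℂ) • φ p

/-- The commutator `[D̃, a]` applied to `φ`. -/
def diracComm (cov : CovariantDerivative 𝓘(ℝ, E) E (fun x : M => TangentSpace 𝓘(ℝ, E) x))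
    (κ : ∀ p : P, S.LocalSection p) (u : ∀ x : M, Fin n ⊕ Fin n → TangentSpace 𝓘(ℝ, E) x)
    (a : M → ℝ) (φ : P → Schw n) (p : P) : Schw n :=
  S.dirac cov κ u (S.mulFun a φ) p - S.mulFun a (S.dirac cov κ u φ) p

/-- The supremum of `|a(x) - a(y)|` over the `a ∈ 𝒞 ⊆ C(M)` for which the fiber norm of `[D̃, a] φ`
is at most `1` at every point of `M`, as an element of `[0, ∞]`. -/
def spectralDist (cov : CovariantDerivative 𝓘(ℝ, E) E (fun x : M => TangentSpace 𝓘(ℝ, E) x))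
    (κ : ∀ p : P, S.LocalSection p) (u : ∀ x : M, Fin n ⊕ Fin n → TangentSpace 𝓘(ℝ, E) x)
    (φ : P → Schw n) (𝒞 : Set C(M, ℝ)) (x y : M) : ℝ≥0∞ :=
  ⨆ a ∈ {a : C(M, ℝ) | a ∈ 𝒞 ∧ ∀ p : P, l2norm (S.diracComm cov κ u a φ p) ≤ 1},
    ENNReal.ofReal |a x - a y|

end MetaplecticStructure

end

end SymplecticSpinor

end

/-! The commutator has order zero: by the Leibniz rule (`covDeriv_mulFun`, `diracComm_eq`) it is
Clifford multiplication by the gradient of `a`. On `Q_0^J` the size of this operator is explicit.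
Summing `(e_j - i f_j)(e_j + i f_j)` over a unitary frame gives `2 H^J + n`, so the eigenvalue
`-n/2` and skew-adjointness force `φ` to be a vacuum vector, killed by every `e_j + i f_j`
(`IsInQ.clifford_inr_eq`). Hence `JX · φ = i X · φ`, and pairing the commutation relation of `X` and
`JX` with `φ` yields `‖X · φ‖² = ½ g(X, X) ‖φ‖²` (`IsInQ.l2norm_clifford_sq`). The normalisation
`‖φ‖² = 2` removes the factor.

The constraint in the supremum is therefore `|da| ≤ 1` everywhere, as in Connes' distance formula.
The supremum is at most the distance because `da` can be integrated along almost shortest paths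
(`ofReal_abs_sub_le_riemannianEDist`). Conversely, the distance from `x` would attain it, but it is
only Lipschitz and may be infinite. It is truncated and then smoothed with almost no loss in the
Lipschitz constant (`IsGeodesicContraction.exists_contMDiff_approx`): near `p` a chart modelled on
`T_pM` is almost an isometry, mollification there keeps Lipschitz constants, and a partition of
unity glues the pieces. The derivatives of the partition contribute only `∑ (g_i - f) dρ_i`, which
is small since `∑ dρ_i = 0`. Rescaling restores the bound `1`. -/

noncomputable section

namespace SymplecticSpinor

/-! ### Symplectic Clifford multiplication on Schwartz functions -/

section Schwartz

variable {n : ℕ}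

/-- The generators of the Clifford multiplication are skew-adjoint for the `L²` inner product. -/
theorem inner_gen_left (k : Fin n ⊕ Fin n) (f g : Schw n) :
    inner ℂ ((gen k f).toLp 2) (g.toLp 2) = -inner ℂ (f.toLp 2) ((gen k g).toLp 2) := by
  rw [SchwartzMap.inner_toL2_toL2_eq _ _ volume, SchwartzMap.inner_toL2_toL2_eq _ _ volume]
  cases k with
  | inl j =>
    rw [← integral_neg]
    congr 1 with ξ
    simp only [gen_inl_apply, RCLike.inner_apply, map_mul, Complex.conj_I, Complex.conj_ofReal]
    ring
  | inr j =>
    -- Integration by parts for the real bilinear pairing `(z, w) ↦ conj z * w`.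
    have h := SchwartzMap.integral_bilinear_lineDerivOp_right_eq_neg_left (μ := volume) f g
      ((ContinuousLinearMap.mul ℝ ℂ) ∘L (Complex.conjCLE : ℂ →L[ℝ] ℂ))
      (EuclideanSpace.single j (1 : ℝ))
    simp only [ContinuousLinearMap.comp_apply, ContinuousLinearMap.mul_apply'] at h
    simp only [RCLike.inner_apply]
    rw [eq_neg_iff_add_eq_zero, add_comm, ← eq_neg_iff_add_eq_zero]
    convert h using 1
    · congr 1 with ξ
      exact mul_comm _ _
    · congr 2 with ξ
      exact mul_comm _ _

theorem gen_inl_comm_gen_inl (i j : Fin n) (f : Schw n) :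
    gen (Sum.inl i) (gen (Sum.inl j) f) = gen (Sum.inl j) (gen (Sum.inl i) f) := by
  ext ξ
  simp only [gen_inl_apply]
  ring

/-- Symmetry of second derivatives. -/
theorem gen_inr_comm_gen_inr (i j : Fin n) (f : Schw n) :
    gen (Sum.inr i) (gen (Sum.inr j) f) = gen (Sum.inr j) (gen (Sum.inr i) f) := by
  have hdiff : ContDiff ℝ 2 f := f.smooth 2
  have key : ∀ (i j : Fin n) (ξ : EuclideanSpace ℝ (Fin n)),
      gen (Sum.inr i) (gen (Sum.inr j) f) ξ =
        fderiv ℝ (fderiv ℝ f) ξ (EuclideanSpace.single i 1) (EuclideanSpace.single j 1) := by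
    intro i j ξ
    have hd : DifferentiableAt ℝ (fderiv ℝ f) ξ :=
      (hdiff.fderiv_right (m := 1) (by norm_num)).differentiable (by norm_num) ξ
    rw [gen_inr_apply]
    have hfun : (gen (Sum.inr j) f : EuclideanSpace ℝ (Fin n) → ℂ) =
        fun η => fderiv ℝ f η (EuclideanSpace.single j 1) := funext fun η => gen_inr_apply j f η
    rw [hfun, fderiv_clm_apply hd (differentiableAt_const _)]
    simp
  ext ξ
  rw [key, key]
  exact (hdiff.contDiffAt.isSymmSndFDerivAt (by simp)).eq _ _

/-- The product rule: differentiating the factor `i ξ_i` along `ξ_j` leaves `i δ_ij`. -/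
theorem gen_inr_gen_inl (i j : Fin n) (f : Schw n) :
    gen (Sum.inr j) (gen (Sum.inl i) f) =
      gen (Sum.inl i) (gen (Sum.inr j) f) + (if i = j then Complex.I else 0) • f := by
  ext ξ
  rw [gen_inr_apply]
  have hfun : (gen (Sum.inl i) f : EuclideanSpace ℝ (Fin n) → ℂ) =
      fun η => Complex.I * (η i : ℂ) * f η := funext fun η => gen_inl_apply i f η
  have hc : HasFDerivAt (fun η : EuclideanSpace ℝ (Fin n) => Complex.I * (η i : ℂ))
      (Complex.I • (Complex.ofRealCLM ∘L
        (EuclideanSpace.proj i : EuclideanSpace ℝ (Fin n) →L[ℝ] ℝ))) ξ :=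
    ((Complex.ofRealCLM ∘L
      (EuclideanSpace.proj i : EuclideanSpace ℝ (Fin n) →L[ℝ] ℝ)).hasFDerivAt).const_mul Complex.I
  rw [hfun, (hc.fun_mul (f.hasFDerivAt ξ)).fderiv]
  simp only [add_apply, smul_apply, gen_inl_apply, gen_inr_apply]
  by_cases h : i = j
  · subst h
    simp [mul_comm]
  · simp [h]

/-- Clifford multiplication by the vector of `ℝ²ⁿ` with coordinates `v`. -/
def cliff (v : Fin n ⊕ Fin n → ℝ) : Schw n →L[ℂ] Schw n := ∑ k, (v k : ℂ) • gen k

theorem cliff_apply (v : Fin n ⊕ Fin n → ℝ) (f : Schw n) :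
    cliff v f = ∑ k, (v k : ℂ) • gen k f := by
  simp [cliff]

theorem toLp_add (f g : Schw n) : (f + g).toLp 2 volume = f.toLp 2 volume + g.toLp 2 volume := rfl

theorem toLp_smul (c : ℂ) (f : Schw n) : (c • f).toLp 2 volume = c • f.toLp 2 volume := rfl

theorem toLp_sum {ι : Type*} (s : Finset ι) (f : ι → Schw n) :
    (∑ i ∈ s, f i).toLp 2 volume = ∑ i ∈ s, (f i).toLp 2 :=
  map_sum (SchwartzMap.toLpCLM ℂ ℂ 2 volume (E := EuclideanSpace ℝ (Fin n))) f s

theorem inner_cliff_left (v : Fin n ⊕ Fin n → ℝ) (f g : Schw n) :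
    inner ℂ ((cliff v f).toLp 2) (g.toLp 2) = -inner ℂ (f.toLp 2) ((cliff v g).toLp 2) := by
  simp only [cliff_apply, toLp_sum, toLp_smul, sum_inner, inner_sum, inner_smul_left,
    inner_smul_right, inner_gen_left, Complex.conj_ofReal, mul_neg, Finset.sum_neg_distrib]

/-- The coefficients of the canonical commutation relations. -/
def commCoeff : Fin n ⊕ Fin n → Fin n ⊕ Fin n → ℝ
  | Sum.inl i, Sum.inr j => if i = j then 1 else 0
  | Sum.inr i, Sum.inl j => if i = j then -1 else 0
  | _, _ => 0

theorem gen_comm (k l : Fin n ⊕ Fin n) (f : Schw n) :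
    gen k (gen l f) - gen l (gen k f) = (-Complex.I * commCoeff k l) • f := by
  rcases k with i | i <;> rcases l with j | j
  · simp [gen_inl_comm_gen_inl i j, commCoeff]
  · rw [gen_inr_gen_inl, sub_add_cancel_left, ← neg_smul]
    congr 1
    by_cases h : i = j <;> simp [commCoeff, h]
  · rw [gen_inr_gen_inl, add_sub_cancel_left]
    congr 1
    by_cases h : i = j
    · simp [commCoeff, h]
    · simp [commCoeff, h, Ne.symm h]
  · simp [gen_inr_comm_gen_inr i j, commCoeff]

theorem cliff_cliff (v w : Fin n ⊕ Fin n → ℝ) (f : Schw n) :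
    cliff v (cliff w f) = ∑ k, ∑ l, ((v k : ℂ) * w l) • gen k (gen l f) := by
  simp only [cliff_apply v, cliff_apply w, map_sum, map_smul, Finset.smul_sum, smul_smul]

/-- The canonical commutation relations. -/
theorem cliff_comm (v w : Fin n ⊕ Fin n → ℝ) (f : Schw n) :
    cliff v (cliff w f) - cliff w (cliff v f) =
      (-Complex.I * ((∑ j, (v (Sum.inl j) * w (Sum.inr j)
        - v (Sum.inr j) * w (Sum.inl j)) : ℝ) : ℂ)) • f := by
  rw [cliff_cliff, cliff_cliff, Finset.sum_comm (f := fun k l => ((w k : ℂ) * v l) • _),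
    ← Finset.sum_sub_distrib]
  simp only [← Finset.sum_sub_distrib, mul_comm ((w _ : ℝ) : ℂ), ← smul_sub, gen_comm, smul_smul,
    ← Finset.sum_smul]
  congr 1
  simp only [Fintype.sum_sum_type, commCoeff]
  simp only [apply_ite (Complex.ofReal), Complex.ofReal_zero, mul_zero, Finset.sum_const_zero,
    zero_add, add_zero, mul_ite, Finset.sum_ite_eq, Finset.mem_univ, if_true,
    ← Finset.sum_add_distrib]
  push_cast
  rw [Finset.mul_sum]
  exact Finset.sum_congr rfl fun j _ => by ring

end Schwartz

end SymplecticSpinor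

end

noncomputable section

namespace SymplecticSpinor

/-! ### Clifford multiplication by tangent vectors -/

section Clifford

variable {E : Type*} [NormedAddCommGroup E] [NormedSpace ℝ E]
  {M : Type*} [TopologicalSpace M] [ChartedSpace E M] [IsManifold 𝓘(ℝ, E) ∞ M]
  [RiemannianBundle (fun x : M => TangentSpace 𝓘(ℝ, E) x)]
  {n : ℕ} {A : AlmostHermitian E M}

namespace AlmostHermitian

theorem form_swap (A : AlmostHermitian E M) (x : M) (X Y : TangentSpace 𝓘(ℝ, E) x) :
    A.form x X Y = -A.form x Y X := by
  have h := A.form_self x (X + Y)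
  simp only [map_add, add_apply, A.form_self] at h
  linarith

/-- Coordinates in a symplectic frame. -/
def coord (A : AlmostHermitian E M) {x : M} (b : Fin n ⊕ Fin n → TangentSpace 𝓘(ℝ, E) x)
    (X : TangentSpace 𝓘(ℝ, E) x) : Fin n ⊕ Fin n → ℝ
  | Sum.inl j => A.form x X (b (Sum.inr j))
  | Sum.inr j => A.form x (b (Sum.inl j)) X

theorem coord_add {x : M} (b : Fin n ⊕ Fin n → TangentSpace 𝓘(ℝ, E) x)
    (X Y : TangentSpace 𝓘(ℝ, E) x) : A.coord b (X + Y) = A.coord b X + A.coord b Y := by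
  ext k
  cases k <;> simp [coord]

theorem coord_smul {x : M} (b : Fin n ⊕ Fin n → TangentSpace 𝓘(ℝ, E) x) (c : ℝ)
    (X : TangentSpace 𝓘(ℝ, E) x) : A.coord b (c • X) = c • A.coord b X := by
  ext k
  cases k <;> simp [coord]

theorem IsSymplecticFrame.coord_self {x : M} {b : Fin n ⊕ Fin n → TangentSpace 𝓘(ℝ, E) x}
    (hb : A.IsSymplecticFrame b) (k l : Fin n ⊕ Fin n) :
    A.coord b (b k) l = if k = l then 1 else 0 := by
  obtain ⟨h1, h2, h3⟩ := hb
  rcases k with i | i <;> rcases l with j | j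
  · simp [coord, h1]
  · simp [coord, h2]
  · simp [coord, h3]
  · simp [coord, h1, eq_comm]

/-- The coordinate functionals `A.coord b` are dual to the frame, so they recover the coefficients
of any linear relation. -/
theorem IsSymplecticFrame.linearIndependent {x : M}
    {b : Fin n ⊕ Fin n → TangentSpace 𝓘(ℝ, E) x} (hb : A.IsSymplecticFrame b) :
    LinearIndependent ℝ b := by
  rw [Fintype.linearIndependent_iff]
  intro c hc l
  let T : TangentSpace 𝓘(ℝ, E) x →ₗ[ℝ] (Fin n ⊕ Fin n → ℝ) :=
    { toFun := A.coord b, map_add' := coord_add b, map_smul' := coord_smul b }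
  have h : T (∑ k, c k • b k) l = 0 := by rw [hc, map_zero]; rfl
  rw [map_sum, Finset.sum_apply] at h
  have h' : ∀ k, T (c k • b k) l = c k * (if k = l then 1 else 0) := fun k => by
    rw [map_smul, Pi.smul_apply, smul_eq_mul, ← hb.coord_self]; rfl
  simpa [h'] using h

/-- A symplectic frame spans the tangent space. -/
theorem IsSymplecticFrame.eq_sum (hE : Module.finrank ℝ E = 2 * n) [FiniteDimensional ℝ E]
    {x : M} {b : Fin n ⊕ Fin n → TangentSpace 𝓘(ℝ, E) x} (hb : A.IsSymplecticFrame b)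
    (X : TangentSpace 𝓘(ℝ, E) x) : X = ∑ k, A.coord b X k • b k := by
  have hcard : Fintype.card (Fin n ⊕ Fin n) = Module.finrank ℝ (TangentSpace 𝓘(ℝ, E) x) := by
    rw [Fintype.card_sum, Fintype.card_fin, ← two_mul, ← hE]; rfl
  -- The basis built from `b` needs a nonempty index type; for `n = 0` the tangent space is trivial.
  rcases isEmpty_or_nonempty (Fin n ⊕ Fin n) with hem | hne
  · have h0 : Module.finrank ℝ E = 0 := by
      rw [show Module.finrank ℝ E = Module.finrank ℝ (TangentSpace 𝓘(ℝ, E) x) from rfl, ← hcard]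
      exact Fintype.card_eq_zero
    have : Subsingleton E := Module.finrank_zero_iff.1 h0
    exact this.elim (_ : E) (_ : E)
  · let B := basisOfLinearIndependentOfCardEqFinrank hb.linearIndependent hcard
    have hB : ∀ k, B k = b k := fun k => by simp [B]
    have hX : X = ∑ k, B.repr X k • b k := by
      conv_lhs => rw [← B.sum_repr X]
      simp [hB]
    have hc : A.coord b X = B.repr X := by
      ext l
      let T : TangentSpace 𝓘(ℝ, E) x →ₗ[ℝ] (Fin n ⊕ Fin n → ℝ) :=
        { toFun := A.coord b, map_add' := coord_add b, map_smul' := coord_smul b }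
      have h : T X l = T (∑ k, B.repr X k • b k) l := by rw [← hX]
      rw [map_sum, Finset.sum_apply] at h
      have h' : ∀ k, T (B.repr X k • b k) l = B.repr X k * (if k = l then 1 else 0) := fun k => by
        rw [map_smul, Pi.smul_apply, smul_eq_mul, ← hb.coord_self]; rfl
      have h'' : T X l = B.repr X l := by simpa [h'] using h
      exact h''
    rw [hc]
    exact hX

theorem IsSymplecticFrame.form_eq_sum (hE : Module.finrank ℝ E = 2 * n) [FiniteDimensional ℝ E]
    {x : M} {b : Fin n ⊕ Fin n → TangentSpace 𝓘(ℝ, E) x} (hb : A.IsSymplecticFrame b)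
    (X Y : TangentSpace 𝓘(ℝ, E) x) :
    A.form x X Y = ∑ j, (A.coord b X (Sum.inl j) * A.coord b Y (Sum.inr j)
      - A.coord b X (Sum.inr j) * A.coord b Y (Sum.inl j)) := by
  conv_lhs => rw [hb.eq_sum hE X]
  rw [map_sum, sum_apply, Fintype.sum_sum_type, ← Finset.sum_add_distrib]
  have h : ∀ k, A.form x (A.coord b X k • b k) Y = A.coord b X k * A.form x (b k) Y := fun k => by
    rw [map_smul]; rfl
  refine Finset.sum_congr rfl fun j _ => ?_
  rw [h, h, A.form_swap x (b (Sum.inr j)) Y]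
  simp only [coord]
  ring

theorem IsUnitaryFrame.eq_sum (hE : Module.finrank ℝ E = 2 * n) [FiniteDimensional ℝ E]
    {x : M} {b : Fin n ⊕ Fin n → TangentSpace 𝓘(ℝ, E) x} (hb : A.IsUnitaryFrame b)
    (X : TangentSpace 𝓘(ℝ, E) x) : X = ∑ k, A.coord b X k • b k :=
  hb.symplectic.eq_sum hE X

end AlmostHermitian

namespace MetaplecticStructure

variable {P : Type*} [TopologicalSpace P]
  [MulAction (Mp n)ᵐᵒᵖ P] (S : MetaplecticStructure n A P)

theorem clifford_eq_cliff (p : P) (X : TangentSpace 𝓘(ℝ, E) (S.proj p)) :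
    S.clifford p X = cliff (A.coord (S.frame p) X) := by
  simp [clifford, cliff, Fintype.sum_sum_type, Finset.sum_add_distrib, AlmostHermitian.coord]

theorem clifford_add (p : P) (X Y : TangentSpace 𝓘(ℝ, E) (S.proj p)) (f : Schw n) :
    S.clifford p (X + Y) f = S.clifford p X f + S.clifford p Y f := by
  simp only [clifford_eq_cliff, AlmostHermitian.coord_add, cliff_apply, Pi.add_apply,
    Complex.ofReal_add, add_smul, Finset.sum_add_distrib]

theorem clifford_smul (p : P) (c : ℝ) (X : TangentSpace 𝓘(ℝ, E) (S.proj p)) (f : Schw n) :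
    S.clifford p (c • X) f = (c : ℂ) • S.clifford p X f := by
  simp only [clifford_eq_cliff, AlmostHermitian.coord_smul, cliff_apply, Pi.smul_apply,
    smul_eq_mul, Complex.ofReal_mul, mul_smul, Finset.smul_sum]

theorem clifford_neg (p : P) (X : TangentSpace 𝓘(ℝ, E) (S.proj p)) (f : Schw n) :
    S.clifford p (-X) f = -S.clifford p X f := by
  have h := S.clifford_smul p (-1) X f
  simpa using h

theorem clifford_sum {ι : Type*} (s : Finset ι) (p : P)
    (X : ι → TangentSpace 𝓘(ℝ, E) (S.proj p)) (f : Schw n) :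
    S.clifford p (∑ i ∈ s, X i) f = ∑ i ∈ s, S.clifford p (X i) f := by
  classical
  induction s using Finset.induction_on with
  | empty => simpa using S.clifford_smul p 0 0 f
  | insert i s hi ih => rw [Finset.sum_insert hi, Finset.sum_insert hi, clifford_add, ih]

theorem inner_clifford_left (p : P) (X : TangentSpace 𝓘(ℝ, E) (S.proj p)) (f g : Schw n) :
    inner ℂ ((S.clifford p X f).toLp 2) (g.toLp 2) =
      -inner ℂ (f.toLp 2) ((S.clifford p X g).toLp 2) := by
  rw [clifford_eq_cliff, inner_cliff_left]

/-- The relation `X · Y · φ - Y · X · φ = -i ω(X, Y) φ`. -/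
theorem clifford_comm (hE : Module.finrank ℝ E = 2 * n) [FiniteDimensional ℝ E] (p : P)
    (X Y : TangentSpace 𝓘(ℝ, E) (S.proj p)) (f : Schw n) :
    S.clifford p X (S.clifford p Y f) - S.clifford p Y (S.clifford p X f) =
      (-Complex.I * (A.form (S.proj p) X Y : ℂ)) • f := by
  rw [clifford_eq_cliff, clifford_eq_cliff, cliff_comm,
    ← (S.frame_symplectic p).form_eq_sum hE]

/-- A section of `Q_0^J` is annihilated by `e_j + i f_j` for every unitary frame `(e, f)`. -/
theorem IsInQ.clifford_inr_eq (hE : Module.finrank ℝ E = 2 * n) [FiniteDimensional ℝ E]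
    {φ : P → Schw n} (hQ : S.IsInQ 0 φ) (p : P)
    {u : Fin n ⊕ Fin n → TangentSpace 𝓘(ℝ, E) (S.proj p)} (hu : A.IsUnitaryFrame u) (j : Fin n) :
    S.clifford p (u (Sum.inr j)) (φ p) = Complex.I • S.clifford p (u (Sum.inl j)) (φ p) := by
  set a : Fin n → Schw n := fun j => S.clifford p (u (Sum.inl j)) (φ p)
    + Complex.I • S.clifford p (u (Sum.inr j)) (φ p) with ha
  -- `(e - i f)(e + i f) = e² + f² + i [e, f]`, and `i [e, f] = i (-i) ω(e, f) = 1`.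
  have hstep : ∀ j, S.clifford p (u (Sum.inl j)) (a j)
      - Complex.I • S.clifford p (u (Sum.inr j)) (a j) =
      S.clifford p (u (Sum.inl j)) (S.clifford p (u (Sum.inl j)) (φ p))
      + S.clifford p (u (Sum.inr j)) (S.clifford p (u (Sum.inr j)) (φ p)) + φ p := by
    intro j
    have hc := S.clifford_comm hE p (u (Sum.inl j)) (u (Sum.inr j)) (φ p)
    rw [hu.symplectic.1 j j, if_pos rfl] at hc
    have hc' : Complex.I • (S.clifford p (u (Sum.inl j)) (S.clifford p (u (Sum.inr j)) (φ p)) -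
      S.clifford p (u (Sum.inr j)) (S.clifford p (u (Sum.inl j)) (φ p))) = φ p := by
      rw [hc, smul_smul]; simp
    rw [smul_sub] at hc'
    simp only [ha, map_add, map_smul, smul_add, smul_smul, Complex.I_mul_I, neg_smul, one_smul]
    refine Eq.trans ?_ (congrArg (fun f => _ + f) hc')
    abel
  have hsum : ∑ j, (S.clifford p (u (Sum.inl j)) (a j)
      - Complex.I • S.clifford p (u (Sum.inr j)) (a j)) = 0 := by
    have hq := hQ p u hu
    rw [Fintype.sum_sum_type, ← Finset.sum_add_distrib] at hq
    simp only [hstep]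
    rw [Finset.sum_add_distrib]
    simp only [Finset.sum_const, Finset.card_univ, Fintype.card_fin]
    have h2 := congrArg (fun f => (2 : ℂ) • f) hq
    simp only [smul_smul] at h2
    norm_num at h2
    rw [h2, ← Nat.cast_smul_eq_nsmul ℂ, ← neg_smul, ← add_smul]
    have : -(2 * ((n : ℂ) / 2)) + n = 0 := by ring
    rw [this, zero_smul]
  -- Both generators are skew-adjoint, so the adjoint of `e - i f` is `-(e + i f)`. The vanishing of
  -- the sum thus becomes the vanishing of a sum of squared norms.
  have hadj : ∀ j, inner ℂ ((φ p).toLp 2) ((S.clifford p (u (Sum.inl j)) (a j)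
      - Complex.I • S.clifford p (u (Sum.inr j)) (a j)).toLp 2 volume) =
      -((‖(a j).toLp 2 volume‖ : ℂ) ^ 2) := by
    intro j
    have e1 := S.inner_clifford_left p (u (Sum.inl j)) (φ p) (a j)
    have e2 := S.inner_clifford_left p (u (Sum.inr j)) (φ p) (a j)
    have e3 : inner ℂ ((a j).toLp 2 volume) ((a j).toLp 2 volume) =
      ((‖(a j).toLp 2 volume‖ : ℂ) ^ 2) := inner_self_eq_norm_sq_to_K _
    rw [← e3]
    have e4 : inner ℂ ((a j).toLp 2 volume) ((a j).toLp 2 volume) =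
        inner ℂ ((S.clifford p (u (Sum.inl j)) (φ p)).toLp 2) ((a j).toLp 2) +
        starRingEnd ℂ Complex.I *
          inner ℂ ((S.clifford p (u (Sum.inr j)) (φ p)).toLp 2) ((a j).toLp 2) := by
      rw [← inner_smul_left, ← inner_add_left]
      rfl
    rw [e4, e1, e2, sub_eq_add_neg, ← neg_smul, toLp_add, toLp_smul, inner_add_right,
      inner_smul_right, Complex.conj_I]
    ring
  have hnorm : ∑ j, ‖(a j).toLp 2 volume‖ ^ 2 = 0 := by
    have h := congrArg (fun f : Schw n => inner ℂ ((φ p).toLp 2 volume) (f.toLp 2 volume)) hsum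
    simp only [toLp_sum, inner_sum, hadj] at h
    have h0 : ((0 : Schw n).toLp 2 volume) = 0 := rfl
    rw [h0, inner_zero_right, Finset.sum_neg_distrib, neg_eq_zero] at h
    exact_mod_cast h
  have haj : a j = 0 := by
    have h := (Finset.sum_eq_zero_iff_of_nonneg (fun j _ => by positivity)).1 hnorm j
      (Finset.mem_univ j)
    have h' : (a j).toLp 2 volume = (0 : Schw n).toLp 2 volume :=
      norm_eq_zero.1 (by simpa using h)
    exact SchwartzMap.injective_toLp 2 volume h'
  have h := congrArg (fun f => Complex.I • f) haj
  simp only [ha, smul_add, smul_smul, Complex.I_mul_I, neg_smul, one_smul, smul_zero] at h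
  exact (sub_eq_zero.1 (by rw [sub_eq_add_neg]; exact h)).symm

/-- On a unitary frame this is `IsInQ.clifford_inr_eq` and its multiple by `i`; both sides are real
linear in `X`. -/
theorem IsInQ.clifford_J_eq (hE : Module.finrank ℝ E = 2 * n) [FiniteDimensional ℝ E]
    {φ : P → Schw n} (hQ : S.IsInQ 0 φ) (p : P)
    {u : Fin n ⊕ Fin n → TangentSpace 𝓘(ℝ, E) (S.proj p)} (hu : A.IsUnitaryFrame u)
    (X : TangentSpace 𝓘(ℝ, E) (S.proj p)) :
    S.clifford p (A.J _ X) (φ p) = Complex.I • S.clifford p X (φ p) := by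
  have hk : ∀ k, S.clifford p (A.J _ (u k)) (φ p) = Complex.I • S.clifford p (u k) (φ p) := by
    rintro (j | j)
    · rw [hu.J_inl, hQ.clifford_inr_eq S hE p hu]
    · rw [hu.J_inr, clifford_neg, hQ.clifford_inr_eq S hE p hu, smul_smul, Complex.I_mul_I,
        neg_one_smul]
  rw [hu.eq_sum hE X]
  simp only [map_sum, map_smul, clifford_sum, clifford_smul, hk, Finset.smul_sum]
  exact Finset.sum_congr rfl fun k _ => smul_comm _ _ _

/-- On `Q_0^J` one has `‖X · φ‖² = ½ g(X, X) ‖φ‖²`. -/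
theorem IsInQ.l2norm_clifford_sq (hE : Module.finrank ℝ E = 2 * n) [FiniteDimensional ℝ E]
    {φ : P → Schw n} (hQ : S.IsInQ 0 φ) (p : P)
    {u : Fin n ⊕ Fin n → TangentSpace 𝓘(ℝ, E) (S.proj p)} (hu : A.IsUnitaryFrame u)
    (X : TangentSpace 𝓘(ℝ, E) (S.proj p)) :
    l2norm (S.clifford p X (φ p)) ^ 2 = ‖X‖ ^ 2 / 2 * l2norm (φ p) ^ 2 := by
  set Y := A.J (S.proj p) X with hY
  have hJ : S.clifford p Y (φ p) = Complex.I • S.clifford p X (φ p) := hQ.clifford_J_eq S hE p hu X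
  have hc := S.clifford_comm hE p X Y (φ p)
  rw [hY, ← A.metric_eq, real_inner_self_eq_norm_sq, ← hY] at hc
  -- With `Y = JX`, the commutator paired with `φ` is `-i ‖X‖² ‖φ‖²`. Skew-adjointness and `Y · φ =
  -- i X · φ` turn the left side into `-2i ‖X · φ‖²`.
  have h := congrArg (fun f : Schw n => inner ℂ ((φ p).toLp 2 volume) (f.toLp 2 volume)) hc
  have e1 := S.inner_clifford_left p X (φ p) (S.clifford p Y (φ p))
  have e2 := S.inner_clifford_left p Y (φ p) (S.clifford p X (φ p))
  rw [hJ, toLp_smul, inner_smul_right] at e1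
  rw [hJ, toLp_smul, inner_smul_left] at e2
  have e3 : inner ℂ ((S.clifford p X (φ p)).toLp 2 volume) ((S.clifford p X (φ p)).toLp 2 volume) =
      ((l2norm (S.clifford p X (φ p)) : ℂ) ^ 2) := inner_self_eq_norm_sq_to_K _
  have e4 : inner ℂ ((φ p).toLp 2 volume) ((φ p).toLp 2 volume) =
      ((l2norm (φ p) : ℂ) ^ 2) := inner_self_eq_norm_sq_to_K _
  rw [e3] at e1 e2
  have hneg : ∀ f g : Schw n, (f - g).toLp 2 volume = f.toLp 2 volume - g.toLp 2 volume :=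
    fun f g => map_sub (SchwartzMap.toLpCLM ℂ ℂ 2 volume (E := EuclideanSpace ℝ (Fin n))) f g
  simp only [hneg, toLp_smul, inner_sub_right, inner_smul_right, e4] at h
  rw [hJ] at h
  simp only [Complex.conj_I] at e2
  have h' : Complex.I * ((l2norm (S.clifford p X (φ p)) : ℂ) ^ 2) =
      Complex.I * (((‖X‖ ^ 2 / 2 * l2norm (φ p) ^ 2 : ℝ)) : ℂ) := by
    push_cast at h ⊢
    linear_combination (-1 / 2 : ℂ) * h + e1 / 2 - e2 / 2
  exact_mod_cast mul_left_cancel₀ Complex.I_ne_zero h'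

end MetaplecticStructure

end Clifford

end SymplecticSpinor

end

/-! ### The Leibniz rule for Schwartz-valued maps and the commutator `[D̃, a]`. -/

noncomputable section

/-- The product rule for a scalar function and a function with values in a topological vector
space. -/
theorem HasFDerivAt.smul_of_topologicalVectorSpace {E : Type*} [NormedAddCommGroup E]
    [NormedSpace ℝ E] {F : Type*} [AddCommGroup F] [Module ℝ F] [TopologicalSpace F]
    [IsTopologicalAddGroup F] [ContinuousSMul ℝ F] {a : E → ℝ} {a' : E →L[ℝ] ℝ} {f : E → F}
    {f' : E →L[ℝ] F} {x : E} (ha : HasFDerivAt a a' x) (hf : HasFDerivAt f f' x) :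
    HasFDerivAt (fun y => a y • f y) (a x • f' + a'.smulRight (f x)) x := by
  rw [hasFDerivAt_iff_isLittleOTVS]
  have h1 : (fun y => a x • (f y - f x - f' (y - x))) =o[ℝ; 𝓝 x] (fun y => y - x) :=
    ((a x • ContinuousLinearMap.id ℝ F).isBigOTVS_fun_comp).trans_isLittleOTVS hf.isLittleOTVS
  have h2 : (fun y => (a y - a x - a' (y - x)) • f x) =o[ℝ; 𝓝 x] (fun y => y - x) :=
    (((ContinuousLinearMap.id ℝ ℝ).smulRight (f x)).isBigOTVS_fun_comp).trans_isLittleOTVS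
      ha.isLittleOTVS
  -- The product of the two increments: `f y - f x` tends to `0`, while `a y - a x` is `O(y - x)`.
  have h3 : (fun y => (a y - a x) • (f y - f x)) =o[ℝ; 𝓝 x] (fun y => y - x) := by
    have ht : Filter.Tendsto (fun y => f y - f x) (𝓝 x) (𝓝 0) := by
      simpa using hf.continuousAt.tendsto.sub_const (f x)
    have := ((Asymptotics.isLittleOTVS_one (𝕜 := ℝ)).2 ht).smul_left (fun y => a y - a x)
    refine this.trans_isBigOTVS ?_
    rw [Asymptotics.isBigOTVS_iff_isBigO]
    simpa using ha.isBigO_sub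
  refine ((h1.add h2).add h3).congr_left fun y => ?_
  simp only [Pi.add_apply, add_apply, smul_apply, ContinuousLinearMap.smulRight_apply]
  module

namespace SymplecticSpinor

section Commutator

variable {E : Type*} [NormedAddCommGroup E] [NormedSpace ℝ E]
  {M : Type*} [TopologicalSpace M] [ChartedSpace E M] {n : ℕ}

/-- The product rule read in the chart at `x`. The target is a Fréchet space, hence the topological
vector space form of the rule. -/
theorem schwDeriv_smul {a : M → ℝ} {f : M → Schw n} {x : M}
    (ha : MDifferentiableAt 𝓘(ℝ, E) 𝓘(ℝ, ℝ) a x)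
    (hf : DifferentiableAt ℝ (f ∘ (extChartAt 𝓘(ℝ, E) x).symm) (extChartAt 𝓘(ℝ, E) x x))
    (X : TangentSpace 𝓘(ℝ, E) x) :
    schwDeriv (E := E) (fun y => a y • f y) x X =
      a x • schwDeriv (E := E) f x X + mvfderiv 𝓘(ℝ, E) a x X • f x := by
  have hd : DifferentiableAt ℝ (a ∘ (extChartAt 𝓘(ℝ, E) x).symm) (extChartAt 𝓘(ℝ, E) x x) := by
    have h : DifferentiableWithinAt ℝ (a ∘ (extChartAt 𝓘(ℝ, E) x).symm) (Set.range 𝓘(ℝ, E))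
      (extChartAt 𝓘(ℝ, E) x x) := ha.differentiableWithinAt_writtenInExtChartAt
    rwa [ModelWithCorners.range_eq_univ, differentiableWithinAt_univ] at h
  have hmv : mvfderiv 𝓘(ℝ, E) a x X =
      fderiv ℝ (a ∘ (extChartAt 𝓘(ℝ, E) x).symm) (extChartAt 𝓘(ℝ, E) x x) X := by
    rw [mvfderiv, ContinuousLinearMap.comp_apply, ha.mfderiv, ModelWithCorners.range_eq_univ,
      fderivWithin_univ]
    rfl
  have h := (hd.hasFDerivAt.smul_of_topologicalVectorSpace hf.hasFDerivAt).fderiv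
  have hx : (extChartAt 𝓘(ℝ, E) x).symm (extChartAt 𝓘(ℝ, E) x x) = x := extChartAt_to_inv x
  rw [hmv]
  have h' := congrArg (fun L : E →L[ℝ] Schw n => L X) h
  simp only [Function.comp_apply, hx] at h'
  exact h'

theorem schwDeriv_congr {f g : M → Schw n} {x : M} (h : f =ᶠ[𝓝 x] g) :
    schwDeriv (E := E) f x = schwDeriv (E := E) g x := by
  unfold schwDeriv
  apply Filter.EventuallyEq.fderiv_eq
  have hc : Filter.Tendsto (extChartAt 𝓘(ℝ, E) x).symm (𝓝 (extChartAt 𝓘(ℝ, E) x x)) (𝓝 x) := by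
    have := continuousAt_extChartAt_symm (I := 𝓘(ℝ, E)) x
    rwa [ContinuousAt, extChartAt_to_inv] at this
  exact hc.eventually h

namespace MetaplecticStructure

variable [IsManifold 𝓘(ℝ, E) ∞ M] [RiemannianBundle (fun x : M => TangentSpace 𝓘(ℝ, E) x)]
  {A : AlmostHermitian E M} {P : Type*} [TopologicalSpace P]
  [MulAction (Mp n)ᵐᵒᵖ P] (S : MetaplecticStructure n A P)
  (cov : CovariantDerivative 𝓘(ℝ, E) E (fun x : M => TangentSpace 𝓘(ℝ, E) x))

theorem covDeriv_mulFun {φ : P → Schw n} (hφ : S.IsSpinor φ) {a : M → ℝ}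
    {p : P} (ha : MDifferentiableAt 𝓘(ℝ, E) 𝓘(ℝ, ℝ) a (S.proj p)) (s : S.LocalSection p)
    (X : TangentSpace 𝓘(ℝ, E) (S.proj p)) :
    S.covDeriv cov (S.mulFun a φ) s X =
      (a (S.proj p) : ℂ) • S.covDeriv cov φ s X
        + (mvfderiv 𝓘(ℝ, E) a (S.proj p) X : ℂ) • φ p := by
  -- Only on the domain of `s` is `s.toFun y` known to lie over `y`.
  have hev : (fun y => S.mulFun a φ (s.toFun y)) =ᶠ[𝓝 (S.proj p)]
      fun y => a y • φ (s.toFun y) := by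
    filter_upwards [s.isOpen.mem_nhds s.mem] with y hy
    rw [mulFun, s.proj_toFun y hy, Complex.coe_smul]
  have hdiff := (hφ.smooth p s 1).2.1 (S.proj p) s.mem
  unfold covDeriv
  rw [schwDeriv_congr hev, schwDeriv_smul ha hdiff, s.toFun_proj]
  -- The connection terms see `φ` only at `p`, so they scale by the value of `a` there; the
  -- derivative term alone produces `da(X) φ`.
  simp only [mulFun, ← Complex.coe_smul, map_smul, ← smul_sub, ← Finset.smul_sum]
  rw [smul_sub, smul_comm (Complex.I / 2)]
  abel

/-- The commutator of the Dirac operator with a function is the Clifford multiplication by its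
gradient. -/
theorem diracComm_eq {φ : P → Schw n} (hφ : S.IsSpinor φ) {a : M → ℝ}
    (κ : ∀ p : P, S.LocalSection p) (u : ∀ x : M, Fin n ⊕ Fin n → TangentSpace 𝓘(ℝ, E) x)
    {p : P} (ha : MDifferentiableAt 𝓘(ℝ, E) 𝓘(ℝ, ℝ) a (S.proj p)) :
    S.diracComm cov κ u a φ p =
      S.clifford p (∑ k, mvfderiv 𝓘(ℝ, E) a (S.proj p) (u (S.proj p) k) • u (S.proj p) k)
        (φ p) := by
  simp only [diracComm, dirac, S.covDeriv_mulFun cov hφ ha, clifford_sum, clifford_smul, map_add,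
    map_smul, Finset.sum_add_distrib]
  simp only [mulFun, dirac, Finset.smul_sum]
  rw [add_sub_cancel_left]

theorem l2norm_diracComm_sq (hE : Module.finrank ℝ E = 2 * n) [FiniteDimensional ℝ E]
    {φ : P → Schw n} (hφ : S.IsSpinor φ) (hQ : S.IsInQ 0 φ) (hnorm : ∀ p, l2norm (φ p) ^ 2 = 2)
    {a : M → ℝ} (κ : ∀ p : P, S.LocalSection p)
    (u : ∀ x : M, Fin n ⊕ Fin n → TangentSpace 𝓘(ℝ, E) x) (hu : ∀ x, A.IsUnitaryFrame (u x))
    {p : P} (ha : MDifferentiableAt 𝓘(ℝ, E) 𝓘(ℝ, ℝ) a (S.proj p)) :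
    l2norm (S.diracComm cov κ u a φ p) ^ 2 = ‖mvfderiv 𝓘(ℝ, E) a (S.proj p)‖ ^ 2 := by
  rw [S.diracComm_eq cov hφ κ u ha, hQ.l2norm_clifford_sq S hE p (hu _), hnorm,
    div_mul_cancel₀ _ two_ne_zero]
  set x := S.proj p
  set d := mvfderiv 𝓘(ℝ, E) a x with hd
  set X := ∑ k, d (u x k) • u x k with hX
  -- `X` is the gradient of `a`; the two inequalities below show that it has the same norm as the
  -- covector it represents.
  have hin : ∀ Y, d Y = inner ℝ X Y := by
    intro Y
    rw [(hu x).eq_sum hE Y]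
    rw [map_sum, inner_sum]
    refine Finset.sum_congr rfl fun k _ => ?_
    rw [map_smul, inner_smul_right, hX, (hu x).orthonormal.inner_left_fintype]
    simp
  congr 1
  apply le_antisymm
  · rcases eq_or_ne X 0 with h0 | h0
    · rw [h0]
      exact (norm_zero (E := TangentSpace 𝓘(ℝ, E) x)).le.trans d.opNorm_nonneg
    · have h1 : ‖X‖ * ‖X‖ ≤ ‖d‖ * ‖X‖ := by
        rw [← real_inner_self_eq_norm_mul_norm, ← hin]
        exact (Real.le_norm_self _).trans (d.le_opNorm X)
      exact le_of_mul_le_mul_right h1 (norm_pos_iff.2 h0)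
  · refine d.opNorm_le_bound (norm_nonneg _) fun Y => ?_
    rw [hin]
    exact norm_inner_le_norm X Y

end MetaplecticStructure

end Commutator

end SymplecticSpinor

end

noncomputable section

namespace SymplecticSpinor

/-! ### Functions with bounded differential are Lipschitz for the geodesic distance -/

/-- The derivative of an everywhere differentiable function need not be integrable. If it is not,
the right side is infinite; if it is, the fundamental theorem of calculus applies. No continuity of
`da` is needed for this reason. -/
theorem ofReal_abs_sub_le_lintegral_deriv {h : ℝ → ℝ} (hd : Differentiable ℝ h) {s t : ℝ}
    (hst : s ≤ t) : ENNReal.ofReal |h t - h s| ≤ ∫⁻ τ in Set.Icc s t, ‖deriv h τ‖ₑ := by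
  by_cases hfin : ∫⁻ τ in Set.Icc s t, ‖deriv h τ‖ₑ = ⊤
  · rw [hfin]; exact le_top
  have hderiv : IntegrableOn (deriv h) (Set.Icc s t) :=
    ⟨(measurable_deriv h).aestronglyMeasurable, lt_top_iff_ne_top.2 hfin⟩
  have hderiv' : IntervalIntegrable (deriv h) volume s t :=
    (intervalIntegrable_iff_integrableOn_Icc_of_le hst).2 hderiv
  rw [← intervalIntegral.integral_eq_sub_of_hasDerivAt (fun τ _ => (hd τ).hasDerivAt) hderiv',
    intervalIntegral.integral_of_le hst, ← integral_Icc_eq_integral_Ioc, ← Real.enorm_eq_ofReal_abs]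
  exact enorm_integral_le_lintegral_enorm _

section

variable {E : Type*} [NormedAddCommGroup E] [NormedSpace ℝ E]
  {M : Type*} [TopologicalSpace M] [ChartedSpace E M]
  [RiemannianBundle (fun x : M => TangentSpace 𝓘(ℝ, E) x)]

theorem ofReal_abs_sub_le_riemannianEDist {a : M → ℝ} (ha : MDifferentiable 𝓘(ℝ, E) 𝓘(ℝ, ℝ) a)
    (hb : ∀ x, ‖mvfderiv 𝓘(ℝ, E) a x‖ ≤ 1) (x y : M) :
    ENNReal.ofReal |a x - a y| ≤ riemannianEDist 𝓘(ℝ, E) x y := by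
  refine le_of_forall_gt fun r hr => ?_
  -- This choice of path is `C¹` on all of `ℝ`, so `a ∘ γ` is differentiable everywhere, endpoints
  -- included.
  obtain ⟨γ, rfl, rfl, hγ, hlen, -, -⟩ :=
    exists_lt_locally_constant_of_riemannianEDist_lt hr zero_lt_one
  refine lt_of_le_of_lt ?_ hlen
  have hγd : MDifferentiable 𝓘(ℝ, ℝ) 𝓘(ℝ, E) γ := hγ.mdifferentiable one_ne_zero
  have hd : Differentiable ℝ (a ∘ γ) := (ha.comp hγd).differentiable
  rw [abs_sub_comm, pathELength_eq_lintegral_mfderiv_Icc]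
  refine (ofReal_abs_sub_le_lintegral_deriv hd zero_le_one).trans ?_
  refine lintegral_mono fun t => ?_
  have h : deriv (a ∘ γ) t = mvfderiv 𝓘(ℝ, E) a (γ t) (mfderiv 𝓘(ℝ, ℝ) 𝓘(ℝ, E) γ t 1) := by
    rw [← mvfderiv_comp_apply t (ha _) (hγd _), mvfderiv, ContinuousLinearMap.comp_apply,
      mfderiv_eq_fderiv, ← fderiv_apply_one_eq_deriv]
    rfl
  rw [h]
  have h1 := (mvfderiv 𝓘(ℝ, E) a (γ t)).le_opNorm (mfderiv 𝓘(ℝ, ℝ) 𝓘(ℝ, E) γ t 1)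
  have h2 : ‖mvfderiv 𝓘(ℝ, E) a (γ t) (mfderiv 𝓘(ℝ, ℝ) 𝓘(ℝ, E) γ t 1)‖ ≤
      ‖mfderiv 𝓘(ℝ, ℝ) 𝓘(ℝ, E) γ t 1‖ :=
    h1.trans (mul_le_of_le_one_left (norm_nonneg _) (hb _))
  rw [← ofReal_norm, ← ofReal_norm]
  exact ENNReal.ofReal_le_ofReal h2

end

/-! ### Smoothing of Lipschitz functions on a vector space -/

open Metric in
/-- Mollification approximates a Lipschitz function uniformly by smooth functions without increasing
the Lipschitz constant. -/
theorem exists_contDiff_lipschitzWith_dist_le {F : Type*} [NormedAddCommGroup F] [NormedSpace ℝ F]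
    [FiniteDimensional ℝ F] {h : F → ℝ} {K : NNReal} (hh : LipschitzWith K h) {δ : ℝ}
    (hδ : 0 < δ) :
    ∃ g : F → ℝ, ContDiff ℝ ∞ g ∧ LipschitzWith K g ∧ ∀ v, |g v - h v| ≤ δ := by
  borelize F
  let μ : Measure F := Measure.addHaar
  -- The `+ 1` keeps the radius meaningful when `K = 0`; still `K ε ≤ δ`.
  let ε : ℝ := δ / (K + 1)
  have hε : 0 < ε := by positivity
  let φ : ContDiffBump (0 : F) := ⟨ε / 2, ε, half_pos hε, half_lt_self hε⟩
  let L := ContinuousLinearMap.lsmul ℝ ℝ (E := ℝ)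
  have hcont : Continuous h := hh.continuous
  have hconv : ConvolutionExists (φ.normed μ) h L μ :=
    φ.hasCompactSupport_normed.convolutionExists_left L φ.continuous_normed
      hcont.locallyIntegrable
  refine ⟨MeasureTheory.convolution (φ.normed μ) h L μ,
    φ.hasCompactSupport_normed.contDiff_convolution_left _ φ.contDiff_normed
      hcont.locallyIntegrable, ?_, fun v => ?_⟩
  -- The convolution averages translates of `h` with nonnegative weights of total mass `1`.
  · refine LipschitzWith.of_dist_le_mul fun v w => ?_
    rw [dist_eq_norm, convolution_def, convolution_def,
      ← integral_sub (hconv v).integrable (hconv w).integrable]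
    have hb : ∀ t, ‖L (φ.normed μ t) (h (v - t)) - L (φ.normed μ t) (h (w - t))‖ ≤
        φ.normed μ t * (K * dist v w) := by
      intro t
      rw [← map_sub]
      simp only [L, ContinuousLinearMap.lsmul_apply, smul_eq_mul, norm_mul,
        Real.norm_of_nonneg (φ.nonneg_normed t)]
      refine mul_le_mul_of_nonneg_left ?_ (φ.nonneg_normed t)
      rw [← dist_eq_norm]
      refine (hh.dist_le_mul _ _).trans_eq ?_
      rw [dist_sub_right]
    refine (norm_integral_le_of_norm_le (φ.integrable_normed.mul_const _)
      (Filter.Eventually.of_forall hb)).trans_eq ?_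
    rw [integral_mul_const, φ.integral_normed, one_mul]
  · rw [← Real.dist_eq]
    refine φ.dist_normed_convolution_le hcont.aestronglyMeasurable fun w hw => ?_
    refine (hh.dist_le_mul w v).trans ?_
    have h1 : dist w v ≤ ε := (mem_ball.1 hw).le
    calc (K : ℝ) * dist w v ≤ (K + 1) * ε := by gcongr; linarith
      _ = δ := by simp only [ε]; field_simp

end SymplecticSpinor

end

noncomputable section

namespace SymplecticSpinor

/-! ### Smoothing of Lipschitz functions in a chart -/

section Chart

variable {E : Type*} [NormedAddCommGroup E] [NormedSpace ℝ E]
  {M : Type*} [TopologicalSpace M] [ChartedSpace E M] [IsManifold 𝓘(ℝ, E) ∞ M]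

theorem mvfderiv_comp_extChartAt {p y : M} (hy : y ∈ (chartAt E p).source) {g : E → ℝ}
    (hg : DifferentiableAt ℝ g (extChartAt 𝓘(ℝ, E) p y)) (v : TangentSpace 𝓘(ℝ, E) y) :
    mvfderiv 𝓘(ℝ, E) (g ∘ extChartAt 𝓘(ℝ, E) p) y v =
      fderiv ℝ g (extChartAt 𝓘(ℝ, E) p y)
        ((trivializationAt E (TangentSpace 𝓘(ℝ, E)) p).continuousLinearMapAt ℝ y v) := by
  rw [mvfderiv_comp_apply y hg.mdifferentiableAt (mdifferentiableAt_extChartAt hy),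
    TangentBundle.continuousLinearMapAt_trivializationAt hy, mvfderiv,
    ContinuousLinearMap.comp_apply, mfderiv_eq_fderiv]
  rfl

theorem mfderiv_extChartAt_symm_comp {p : M} {η : ℝ → E} {t : ℝ}
    (ht : η t ∈ (extChartAt 𝓘(ℝ, E) p).target) (hη : DifferentiableAt ℝ η t) :
    mfderiv 𝓘(ℝ, ℝ) 𝓘(ℝ, E) ((extChartAt 𝓘(ℝ, E) p).symm ∘ η) t 1 =
      (trivializationAt E (TangentSpace 𝓘(ℝ, E)) p).symmL ℝ ((extChartAt 𝓘(ℝ, E) p).symm (η t))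
        (deriv η t) := by
  have hsrc : (extChartAt 𝓘(ℝ, E) p).symm (η t) ∈ (chartAt E p).source := by
    rw [← extChartAt_source 𝓘(ℝ, E)]
    exact (extChartAt 𝓘(ℝ, E) p).map_target ht
  have hsymm : MDifferentiableAt 𝓘(ℝ, E) 𝓘(ℝ, E) (extChartAt 𝓘(ℝ, E) p).symm (η t) := by
    have := mdifferentiableWithinAt_extChartAt_symm (I := 𝓘(ℝ, E)) ht
    rwa [ModelWithCorners.range_eq_univ, mdifferentiableWithinAt_univ] at this
  rw [mfderiv_comp_apply t hsymm hη.mdifferentiableAt, TangentBundle.symmL_trivializationAt hsrc,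
    ModelWithCorners.range_eq_univ, mfderivWithin_univ, (extChartAt 𝓘(ℝ, E) p).right_inv ht,
    mfderiv_eq_fderiv, ← fderiv_apply_one_eq_deriv]
  rfl

variable [RiemannianBundle (fun x : M => TangentSpace 𝓘(ℝ, E) x)]

/-- A chart does not increase lengths by more than the norm of its differential. -/
theorem riemannianEDist_extChartAt_symm_le {F : Type*} [NormedAddCommGroup F] [NormedSpace ℝ F]
    (L : F →L[ℝ] E) {p : M} {r : NNReal} {V : Set F} (hV : Convex ℝ V)
    (htarget : ∀ v ∈ V, L v ∈ (extChartAt 𝓘(ℝ, E) p).target)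
    (hb : ∀ v ∈ V, ∀ w, ‖(trivializationAt E (TangentSpace 𝓘(ℝ, E)) p).symmL ℝ
      ((extChartAt 𝓘(ℝ, E) p).symm (L v)) (L w)‖ ≤ r * ‖w‖)
    {v w : F} (hv : v ∈ V) (hw : w ∈ V) :
    riemannianEDist 𝓘(ℝ, E) ((extChartAt 𝓘(ℝ, E) p).symm (L v))
      ((extChartAt 𝓘(ℝ, E) p).symm (L w)) ≤ r * edist v w := by
  -- The competing path is the image of the straight segment, which stays in the convex set `V`.
  let η : ℝ → F := AffineMap.lineMap v w
  have hη : ∀ t, HasDerivAt η (w - v) t := fun t => AffineMap.hasDerivAt_lineMap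
  have hmem : ∀ t ∈ Set.Icc (0 : ℝ) 1, η t ∈ V := fun t ht =>
    hV.segment_subset hv hw (segment_eq_image_lineMap ℝ v w ▸ Set.mem_image_of_mem _ ht)
  have hLη : ∀ t, HasDerivAt (fun t => L (η t)) (L (w - v)) t := fun t =>
    L.hasFDerivAt.comp_hasDerivAt t (hη t)
  have hsmooth : ContMDiffOn 𝓘(ℝ, ℝ) 𝓘(ℝ, E) 1 ((extChartAt 𝓘(ℝ, E) p).symm ∘ fun t => L (η t))
      (Set.Icc 0 1) := by
    refine (contMDiffOn_extChartAt_symm p).comp (t := (extChartAt 𝓘(ℝ, E) p).target) ?_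
      fun t ht => htarget _ (hmem t ht)
    exact ((L.contDiff.comp
      (ContinuousAffineMap.lineMap (R := ℝ) v w).contDiff).contMDiff).contMDiffOn
  have h := riemannianEDist_le_pathELength hsmooth rfl rfl zero_le_one
  simp only [Function.comp_apply, η, AffineMap.lineMap_apply_zero, AffineMap.lineMap_apply_one] at h
  refine h.trans ?_
  rw [pathELength_eq_lintegral_mfderiv_Icc]
  have hbound : ∀ t ∈ Set.Icc (0 : ℝ) 1,
      ‖mfderiv 𝓘(ℝ, ℝ) 𝓘(ℝ, E) ((extChartAt 𝓘(ℝ, E) p).symm ∘ fun t => L (η t)) t 1‖ₑ ≤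
        r * edist v w := by
    intro t ht
    rw [mfderiv_extChartAt_symm_comp (htarget _ (hmem t ht)) (hLη t).differentiableAt,
      (hLη t).deriv, edist_comm, edist_eq_enorm_sub, ← ofReal_norm, ← ofReal_norm,
      ← ENNReal.ofReal_coe_nnreal, ← ENNReal.ofReal_mul r.coe_nonneg]
    exact ENNReal.ofReal_le_ofReal (hb _ (hmem t ht) _)
  refine (setLIntegral_mono' measurableSet_Icc hbound).trans ?_
  simp

/-- `f` is `1`-Lipschitz for the geodesic distance. -/
def IsGeodesicContraction (E : Type*) [NormedAddCommGroup E] [NormedSpace ℝ E]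
    {M : Type*} [TopologicalSpace M] [ChartedSpace E M]
    [RiemannianBundle (fun x : M => TangentSpace 𝓘(ℝ, E) x)] (f : M → ℝ) : Prop :=
  ∀ x y, ENNReal.ofReal |f x - f y| ≤ riemannianEDist 𝓘(ℝ, E) x y

/-- Read in the chart, `f` is `r`-Lipschitz on `V`; extend it to `F` with the same constant, mollify
and pull back. One factor `r` is that constant, the other bounds the differential of the chart. -/
theorem exists_contMDiffOn_chart_approx {F : Type*} [NormedAddCommGroup F] [NormedSpace ℝ F]
    [FiniteDimensional ℝ F] (L : F ≃L[ℝ] E) {p : M} {r : NNReal} {V : Set F} (hV : Convex ℝ V)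
    (htarget : ∀ v ∈ V, L v ∈ (extChartAt 𝓘(ℝ, E) p).target)
    (hb : ∀ v ∈ V, ∀ w, ‖(trivializationAt E (TangentSpace 𝓘(ℝ, E)) p).symmL ℝ
      ((extChartAt 𝓘(ℝ, E) p).symm (L v)) (L w)‖ ≤ r * ‖w‖)
    {U : Set M} (hU : ∀ y ∈ U, y ∈ (chartAt E p).source ∧ L.symm (extChartAt 𝓘(ℝ, E) p y) ∈ V)
    (hb' : ∀ y ∈ U, ∀ v : TangentSpace 𝓘(ℝ, E) y,
      ‖L.symm ((trivializationAt E (TangentSpace 𝓘(ℝ, E)) p).continuousLinearMapAt ℝ y v)‖ ≤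
        r * ‖v‖)
    {f : M → ℝ} (hf : IsGeodesicContraction E f) {δ : ℝ} (hδ : 0 < δ) :
    ∃ g : M → ℝ, (∀ y ∈ U, ContMDiffAt 𝓘(ℝ, E) 𝓘(ℝ, ℝ) ∞ g y) ∧ (∀ y ∈ U, |g y - f y| ≤ δ) ∧
      ∀ y ∈ U, ‖mvfderiv 𝓘(ℝ, E) g y‖ ≤ r * r := by
  have hlip : LipschitzOnWith r (fun v => f ((extChartAt 𝓘(ℝ, E) p).symm (L v))) V := by
    intro v hv w hw
    rw [edist_dist, Real.dist_eq]
    exact (hf _ _).trans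
      (riemannianEDist_extChartAt_symm_le (L : F →L[ℝ] E) hV htarget hb hv hw)
  obtain ⟨h, hh, heq⟩ := hlip.extend_real
  obtain ⟨k, hk, hkl, hkd⟩ := exists_contDiff_lipschitzWith_dist_le hh hδ
  have hg : ContDiff ℝ ∞ (k ∘ L.symm) := hk.comp L.symm.contDiff
  refine ⟨(k ∘ L.symm) ∘ extChartAt 𝓘(ℝ, E) p, fun y hy => ?_, fun y hy => ?_, fun y hy => ?_⟩
  · exact hg.contMDiff.contMDiffAt.comp y (contMDiffAt_extChartAt' (hU y hy).1)
  · have h1 := hkd (L.symm (extChartAt 𝓘(ℝ, E) p y))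
    rw [← heq (hU y hy).2] at h1
    simp only [L.apply_symm_apply] at h1
    rwa [(extChartAt 𝓘(ℝ, E) p).left_inv (by simpa using (hU y hy).1)] at h1
  · refine ContinuousLinearMap.opNorm_le_bound _ (by positivity) fun v => ?_
    rw [mvfderiv_comp_extChartAt (hU y hy).1 (hg.differentiable (by simp) _),
      fderiv_comp _ (hk.differentiable (by simp) _) L.symm.differentiableAt]
    rw [ContinuousLinearMap.comp_apply, L.symm.fderiv]
    refine ((fderiv ℝ k _).le_opNorm _).trans ?_
    rw [mul_assoc]
    exact mul_le_mul (norm_fderiv_le_of_lipschitz ℝ hkl) (hb' y hy v) (norm_nonneg _) r.2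

/-- A smooth Riemannian metric on the tangent bundle is continuous. -/
instance isContinuousRiemannianBundle_tangentSpace 
    [IsContMDiffRiemannianBundle 𝓘(ℝ, E) ∞ E (fun x : M => TangentSpace 𝓘(ℝ, E) x)] :
    IsContinuousRiemannianBundle E (fun x : M => TangentSpace 𝓘(ℝ, E) x) := by
  obtain ⟨g, hg, h⟩ := IsContMDiffRiemannianBundle.exists_contMDiff (IB := 𝓘(ℝ, E)) (n := ∞)
    (F := E) (E := fun x : M => TangentSpace 𝓘(ℝ, E) x)
  exact ⟨g, hg.continuous, h⟩

/-- Every point has a neighbourhood on which contractions for the geodesic distance are uniform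
limits of smooth functions whose differentials are almost bounded by `1`. -/
theorem exists_nhds_contMDiffOn_approx [FiniteDimensional ℝ E]
    [IsContMDiffRiemannianBundle 𝓘(ℝ, E) ∞ E (fun x : M => TangentSpace 𝓘(ℝ, E) x)]
    (p : M) {r : ℝ} (hr : 1 < r) :
    ∃ U : Set M, IsOpen U ∧ p ∈ U ∧ ∀ f : M → ℝ, IsGeodesicContraction E f → ∀ δ > 0,
      ∃ g : M → ℝ, (∀ y ∈ U, ContMDiffAt 𝓘(ℝ, E) 𝓘(ℝ, ℝ) ∞ g y) ∧ (∀ y ∈ U, |g y - f y| ≤ δ) ∧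
        ∀ y ∈ U, ‖mvfderiv 𝓘(ℝ, E) g y‖ ≤ r := by
  have hs : 1 < √r := by rwa [Real.lt_sqrt zero_le_one, one_pow]
  have hp : p ∈ (trivializationAt E (TangentSpace 𝓘(ℝ, E) : M → Type _) p).baseSet :=
    FiberBundle.mem_baseSet_trivializationAt' p
  -- The chart is modelled on `T_pM` with its Riemannian norm, since the norm of `E` is unrelated to
  -- the metric. Its differential and the inverse then have norm below `√r` near `p`, and two
  -- factors `√r` make `r`.
  let L : TangentSpace 𝓘(ℝ, E) p ≃L[ℝ] E :=
    (trivializationAt E (TangentSpace 𝓘(ℝ, E)) p).continuousLinearEquivAt ℝ p hp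
  have hL : ∀ w, L w = (trivializationAt E (TangentSpace 𝓘(ℝ, E)) p).continuousLinearMapAt ℝ p w :=
    fun w => congrFun (Trivialization.coe_continuousLinearEquivAt_eq _ hp) w
  have hLs : ∀ z, L.symm z = (trivializationAt E (TangentSpace 𝓘(ℝ, E)) p).symmL ℝ p z :=
    fun z => congrFun (Trivialization.symm_continuousLinearEquivAt_eq _ hp) z
  have hfin : FiniteDimensional ℝ (TangentSpace 𝓘(ℝ, E) p) :=
    L.symm.toLinearEquiv.finiteDimensional
  have h1 := eventually_norm_symmL_trivializationAt_self_comp_lt E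
    (fun x : M => TangentSpace 𝓘(ℝ, E) x) p hs
  have h2 := eventually_norm_symmL_trivializationAt_comp_self_lt E
    (fun x : M => TangentSpace 𝓘(ℝ, E) x) p hs
  let ψ : TangentSpace 𝓘(ℝ, E) p → M := fun v => (extChartAt 𝓘(ℝ, E) p).symm (L v)
  have hψ0 : L (L.symm (extChartAt 𝓘(ℝ, E) p p)) = extChartAt 𝓘(ℝ, E) p p := L.apply_symm_apply _
  have hψ : Filter.Tendsto ψ (𝓝 (L.symm (extChartAt 𝓘(ℝ, E) p p))) (𝓝 p) := by
    have ha : ContinuousAt (extChartAt 𝓘(ℝ, E) p).symm (L (L.symm (extChartAt 𝓘(ℝ, E) p p))) := by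
      rw [hψ0]; exact continuousAt_extChartAt_symm p
    have hb := ContinuousAt.comp (f := L) ha L.continuous.continuousAt
    rw [ContinuousAt, Function.comp_apply, hψ0, extChartAt_to_inv] at hb
    exact hb
  have htgt : ∀ᶠ v in 𝓝 (L.symm (extChartAt 𝓘(ℝ, E) p p)), L v ∈ (extChartAt 𝓘(ℝ, E) p).target :=
    L.continuous.continuousAt.preimage_mem_nhds (by rw [hψ0]; exact extChartAt_target_mem_nhds p)
  obtain ⟨ε, hε, hball⟩ := Metric.eventually_nhds_iff_ball.1 ((hψ.eventually h2).and htgt)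
  let r₀ : NNReal := ⟨√r, Real.sqrt_nonneg r⟩
  have hr₀ : (r₀ : ℝ) * r₀ = r := Real.mul_self_sqrt (by linarith)
  let G : Set M := {y | (y ∈ (chartAt E p).source ∧ L.symm (extChartAt 𝓘(ℝ, E) p y) ∈
    Metric.ball (L.symm (extChartAt 𝓘(ℝ, E) p p)) ε) ∧
    ‖((trivializationAt E (TangentSpace 𝓘(ℝ, E)) p).symmL ℝ p) ∘L
      ((trivializationAt E (TangentSpace 𝓘(ℝ, E)) p).continuousLinearMapAt ℝ y)‖ < √r}
  have hG : G ∈ 𝓝 p := by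
    have hc : ContinuousAt (fun y => L.symm (extChartAt 𝓘(ℝ, E) p y)) p :=
      L.symm.continuous.continuousAt.comp (continuousAt_extChartAt p)
    exact Filter.inter_mem (Filter.inter_mem (chart_source_mem_nhds E p)
      (hc.preimage_mem_nhds (Metric.ball_mem_nhds _ hε))) h1
  refine ⟨interior G, isOpen_interior, mem_interior_iff_mem_nhds.2 hG, fun f hf δ hδ => ?_⟩
  rw [← hr₀]
  refine exists_contMDiffOn_chart_approx L (V := Metric.ball (L.symm (extChartAt 𝓘(ℝ, E) p p)) ε)
    (convex_ball _ _) (fun v hv => (hball v hv).2) (fun v hv w => ?_)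
    (fun y hy => (interior_subset hy).1) (fun y hy v => ?_) hf hδ
  · rw [hL w]
    exact ContinuousLinearMap.le_of_opNorm_le _ (hball v hv).1.le w
  · rw [hLs]
    exact ContinuousLinearMap.le_of_opNorm_le _ (interior_subset hy).2.le v

end Chart

end SymplecticSpinor

end

noncomputable section

namespace SymplecticSpinor

/-! ### Smoothing of Lipschitz functions on a compact manifold -/

section Global

variable {E : Type*} [NormedAddCommGroup E] [NormedSpace ℝ E]
  {M : Type*} [TopologicalSpace M] [ChartedSpace E M]

theorem mvfderiv_congr {f g : M → ℝ} {x : M} (h : f =ᶠ[𝓝 x] g) :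
    mvfderiv 𝓘(ℝ, E) f x = mvfderiv 𝓘(ℝ, E) g x := by
  ext v
  simp only [mvfderiv, ContinuousLinearMap.comp_apply, h.mfderiv_eq]
  rfl

theorem mvfderiv_finset_sum {ι : Type*} (s : Finset ι) {f : ι → M → ℝ} {x : M}
    (hf : ∀ i ∈ s, MDifferentiableAt 𝓘(ℝ, E) 𝓘(ℝ, ℝ) (f i) x) :
    mvfderiv 𝓘(ℝ, E) (fun y => ∑ i ∈ s, f i y) x = ∑ i ∈ s, mvfderiv 𝓘(ℝ, E) (f i) x := by
  classical
  suffices h : MDifferentiableAt 𝓘(ℝ, E) 𝓘(ℝ, ℝ) (fun y => ∑ i ∈ s, f i y) x ∧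
      mvfderiv 𝓘(ℝ, E) (fun y => ∑ i ∈ s, f i y) x = ∑ i ∈ s, mvfderiv 𝓘(ℝ, E) (f i) x from h.2
  induction s using Finset.induction_on with
  | empty => simpa using ⟨mdifferentiableAt_const, mvfderiv_const (0 : ℝ)⟩
  | insert i s hi ih =>
    obtain ⟨h1, h2⟩ := ih fun j hj => hf j (Finset.mem_insert_of_mem hj)
    have h3 := hf i (Finset.mem_insert_self i s)
    simp only [Finset.sum_insert hi]
    exact ⟨h3.add h1, (mvfderiv_add h3 h1).trans (by rw [h2])⟩

variable [IsManifold 𝓘(ℝ, E) ∞ M]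
  [RiemannianBundle (fun x : M => TangentSpace 𝓘(ℝ, E) x)]
  [IsContMDiffRiemannianBundle 𝓘(ℝ, E) ∞ E (fun x : M => TangentSpace 𝓘(ℝ, E) x)]

/-- In a chart the derivative is continuous, and the trivialization has bounded norm near `p`. -/
theorem eventually_norm_mvfderiv_le {ρ : M → ℝ} (hρ : ContMDiff 𝓘(ℝ, E) 𝓘(ℝ, ℝ) ∞ ρ) (p : M) :
    ∃ C : ℝ, ∀ᶠ y in 𝓝 p, ‖mvfderiv 𝓘(ℝ, E) ρ y‖ ≤ C := by
  obtain ⟨C, hC0, hC⟩ := eventually_norm_trivializationAt_lt E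
    (fun x : M => TangentSpace 𝓘(ℝ, E) x) p
  set g : E → ℝ := ρ ∘ (extChartAt 𝓘(ℝ, E) p).symm with hg
  have hgs : ContDiffOn ℝ ∞ g (extChartAt 𝓘(ℝ, E) p).target :=
    contMDiffOn_iff_contDiffOn.1 (hρ.comp_contMDiffOn (contMDiffOn_extChartAt_symm p))
  have hopen : IsOpen (extChartAt 𝓘(ℝ, E) p).target := isOpen_extChartAt_target p
  have hcont : ContinuousAt (fderiv ℝ g) (extChartAt 𝓘(ℝ, E) p p) :=
    (hgs.continuousOn_fderiv_of_isOpen hopen (by simp)).continuousAt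
      (extChartAt_target_mem_nhds p)
  have hev : ∀ᶠ y in 𝓝 p, ‖fderiv ℝ g (extChartAt 𝓘(ℝ, E) p y)‖ <
      ‖fderiv ℝ g (extChartAt 𝓘(ℝ, E) p p)‖ + 1 :=
    (hcont.norm.comp (f := extChartAt 𝓘(ℝ, E) p) (continuousAt_extChartAt p)).eventually_lt_const
      (lt_add_one _)
  refine ⟨(‖fderiv ℝ g (extChartAt 𝓘(ℝ, E) p p)‖ + 1) * C, ?_⟩
  filter_upwards [hev, hC, chart_source_mem_nhds E p] with y h1 h2 h3
  have h3' : y ∈ (extChartAt 𝓘(ℝ, E) p).source := by simpa using h3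
  have hcongr : ρ =ᶠ[𝓝 y] g ∘ extChartAt 𝓘(ℝ, E) p := by
    filter_upwards [(isOpen_extChartAt_source p).mem_nhds h3'] with z hz
    simp only [hg, Function.comp_apply, (extChartAt 𝓘(ℝ, E) p).left_inv hz]
  rw [mvfderiv_congr hcongr]
  refine ContinuousLinearMap.opNorm_le_bound _ (by positivity) fun v => ?_
  have hd : DifferentiableAt ℝ g (extChartAt 𝓘(ℝ, E) p y) :=
    (hgs.differentiableOn (by simp)).differentiableAt
      (hopen.mem_nhds ((extChartAt 𝓘(ℝ, E) p).map_source h3'))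
  rw [mvfderiv_comp_extChartAt h3 hd]
  refine ((fderiv ℝ g _).le_opNorm _).trans ?_
  rw [mul_assoc]
  exact mul_le_mul h1.le (ContinuousLinearMap.le_of_opNorm_le _ h2.le v) (norm_nonneg _)
    (by positivity)

theorem exists_norm_mvfderiv_le [CompactSpace M] {ρ : M → ℝ}
    (hρ : ContMDiff 𝓘(ℝ, E) 𝓘(ℝ, ℝ) ∞ ρ) : ∃ C : ℝ, ∀ y, ‖mvfderiv 𝓘(ℝ, E) ρ y‖ ≤ C := by
  choose C hC using eventually_norm_mvfderiv_le hρ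
  obtain ⟨t, -, ht⟩ := isCompact_univ.elim_nhds_subcover
    (fun p => {y | ‖mvfderiv 𝓘(ℝ, E) ρ y‖ ≤ C p}) (fun p _ => hC p)
  refine ⟨∑ p ∈ t, |C p|, fun y => ?_⟩
  obtain ⟨p, hp, hy⟩ := Set.mem_iUnion₂.1 (ht (Set.mem_univ y))
  exact (le_trans hy (le_abs_self _)).trans
    (Finset.single_le_sum (f := fun p => |C p|) (fun _ _ => abs_nonneg _) hp)

/-- On a compact Riemannian manifold, a contraction for the geodesic distance is a uniform limit of
smooth functions whose differentials are almost bounded by `1`. -/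
theorem IsGeodesicContraction.exists_contMDiff_approx [FiniteDimensional ℝ E] [T2Space M]
    [CompactSpace M] {f : M → ℝ} (hf : IsGeodesicContraction E f) {r : ℝ} (hr : 1 < r) {δ : ℝ}
    (hδ : 0 < δ) :
    ∃ a : M → ℝ, ContMDiff 𝓘(ℝ, E) 𝓘(ℝ, ℝ) ∞ a ∧ (∀ y, |a y - f y| ≤ δ) ∧
      ∀ y, ‖mvfderiv 𝓘(ℝ, E) a y‖ ≤ r := by
  -- The gap `r - r'` is reserved for the derivatives of the partition of unity. The sets `U` below
  -- do not depend on the accuracy, so the partition and its bounds `C` can be fixed before `ε`.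
  obtain ⟨r', hr', hr'r⟩ := exists_between hr
  choose U hUo hUp hU using fun p : M =>
    exists_nhds_contMDiffOn_approx (E := E) (M := M) p hr'
  obtain ⟨t, -, ht⟩ := isCompact_univ.elim_nhds_subcover U
    (fun p _ => (hUo p).mem_nhds (hUp p))
  obtain ⟨ρ, hρ⟩ := SmoothPartitionOfUnity.exists_isSubordinate 𝓘(ℝ, E) (isClosed_univ (X := M))
    (fun i : t => U i) (fun i => hUo i) (by
      intro y hy
      obtain ⟨p, hp, hy⟩ := Set.mem_iUnion₂.1 (ht hy)
      exact Set.mem_iUnion.2 ⟨⟨p, hp⟩, hy⟩)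
  choose C hC using fun i : t => exists_norm_mvfderiv_le (E := E) (ρ i).contMDiff
  have hCC : 0 ≤ ∑ i, |C i| := Finset.sum_nonneg fun i _ => abs_nonneg _
  obtain ⟨ε, hε, hεδ, hεr⟩ : ∃ ε > 0, ε ≤ δ ∧ r' + ε * ∑ i, |C i| ≤ r := by
    refine ⟨min δ ((r - r') / (∑ i, |C i| + 1)), lt_min hδ (div_pos (by linarith) (by positivity)),
      min_le_left _ _, ?_⟩
    have h1 : min δ ((r - r') / (∑ i, |C i| + 1)) * ∑ i, |C i| ≤
        (r - r') / (∑ i, |C i| + 1) * (∑ i, |C i| + 1) := by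
      refine mul_le_mul (min_le_right _ _) (by linarith) hCC ?_
      exact div_nonneg (by linarith) (by positivity)
    rw [div_mul_cancel₀ _ (by positivity)] at h1
    linarith
  choose g hgs hgd hgn using fun i : t => hU i f hf ε hε
  have hmem : ∀ (i : t) (y : M), y ∈ tsupport (ρ i) → y ∈ U i := fun i y hy => hρ i hy
  have hsum : ∀ y, ∑ i, ρ i y = 1 := fun y => by
    rw [← finsum_eq_sum_of_fintype]; exact ρ.sum_eq_one (Set.mem_univ y)
  have hsm : ∀ i, ContMDiff 𝓘(ℝ, E) 𝓘(ℝ, ℝ) ∞ (fun y => ρ i y * g i y) := fun i =>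
    ρ.contMDiff_smul (n := ⊤) fun y hy => hgs i y (hmem i y hy)
  have hdρ : ∀ i y, y ∉ tsupport (ρ i) → mvfderiv 𝓘(ℝ, E) (ρ i) y = 0 := fun i y hy => by
    rw [mvfderiv_congr (notMem_tsupport_iff_eventuallyEq.1 hy)]
    exact mvfderiv_zero
  have hdprod : ∀ i y, mvfderiv 𝓘(ℝ, E) (fun y => ρ i y * g i y) y =
      ρ i y • mvfderiv 𝓘(ℝ, E) (g i) y + g i y • mvfderiv 𝓘(ℝ, E) (ρ i) y := by
    intro i y
    by_cases hy : y ∈ tsupport (ρ i)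
    · exact mvfderiv_mul ((ρ i).contMDiff.mdifferentiable (by simp) y)
        ((hgs i y (hmem i y hy)).mdifferentiableAt (by simp))
    -- Off the support `g i` may fail to be differentiable, but both sides vanish.
    · have h0 : (fun y => ρ i y * g i y) =ᶠ[𝓝 y] (0 : M → ℝ) := by
        filter_upwards [notMem_tsupport_iff_eventuallyEq.1 hy] with z hz
        simp [hz]
      rw [mvfderiv_congr h0, hdρ i y hy, image_eq_zero_of_notMem_tsupport hy]
      simp [mvfderiv_zero]
  have hdsum : ∀ y, ∑ i, mvfderiv 𝓘(ℝ, E) (ρ i) y = 0 := by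
    intro y
    rw [← mvfderiv_finset_sum _ fun i _ => (ρ i).contMDiff.mdifferentiable (by simp) y]
    simp only [hsum]
    exact mvfderiv_const _
  refine ⟨fun y => ∑ i, ρ i y * g i y, contMDiff_finsetSum fun i _ => hsm i, fun y => ?_,
    fun y => ?_⟩
  · have h1 : ∑ i, ρ i y * g i y - f y = ∑ i, ρ i y * (g i y - f y) := by
      simp only [mul_sub, Finset.sum_sub_distrib, ← Finset.sum_mul, hsum, one_mul]
    rw [h1]
    calc |∑ i, ρ i y * (g i y - f y)| ≤ ∑ i, |ρ i y * (g i y - f y)| :=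
          Finset.abs_sum_le_sum_abs _ _
      _ ≤ ∑ i, ρ i y * δ := by
          refine Finset.sum_le_sum fun i _ => ?_
          rw [abs_mul, abs_of_nonneg (ρ.nonneg i y)]
          by_cases hy : y ∈ tsupport (ρ i)
          · exact mul_le_mul_of_nonneg_left ((hgd i y (hmem i y hy)).trans hεδ) (ρ.nonneg i y)
          · simp [image_eq_zero_of_notMem_tsupport hy]
      _ = δ := by rw [← Finset.sum_mul, hsum, one_mul]
  -- Since `∑ dρ_i = 0`, the constant `f y` may be subtracted from each coefficient; no derivative
  -- of `f` occurs.
  · have h1 : mvfderiv 𝓘(ℝ, E) (fun y => ∑ i, ρ i y * g i y) y =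
        ∑ i, ρ i y • mvfderiv 𝓘(ℝ, E) (g i) y
          + ∑ i, (g i y - f y) • mvfderiv 𝓘(ℝ, E) (ρ i) y := by
      rw [mvfderiv_finset_sum _ fun i _ => (hsm i).mdifferentiable (by simp) y]
      simp only [hdprod, sub_smul, Finset.sum_add_distrib, Finset.sum_sub_distrib,
        ← Finset.smul_sum, hdsum, smul_zero, sub_zero]
    refine ContinuousLinearMap.opNorm_le_bound _ (by linarith) fun v => ?_
    have h2 : mvfderiv 𝓘(ℝ, E) (fun y => ∑ i, ρ i y * g i y) y v =
        ∑ i, ρ i y * mvfderiv 𝓘(ℝ, E) (g i) y v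
          + ∑ i, (g i y - f y) * mvfderiv 𝓘(ℝ, E) (ρ i) y v := by
      rw [h1, add_apply, sum_apply, sum_apply]
      rfl
    have h3 : |∑ i, ρ i y * mvfderiv 𝓘(ℝ, E) (g i) y v| ≤ r' * ‖v‖ :=
      calc |∑ i, ρ i y * mvfderiv 𝓘(ℝ, E) (g i) y v|
          ≤ ∑ i, |ρ i y * mvfderiv 𝓘(ℝ, E) (g i) y v| := Finset.abs_sum_le_sum_abs _ _
        _ ≤ ∑ i, ρ i y * (r' * ‖v‖) := by
            refine Finset.sum_le_sum fun i _ => ?_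
            rw [abs_mul, abs_of_nonneg (ρ.nonneg i y)]
            by_cases hy : y ∈ tsupport (ρ i)
            · exact mul_le_mul_of_nonneg_left
                (ContinuousLinearMap.le_of_opNorm_le _ (hgn i y (hmem i y hy)) v) (ρ.nonneg i y)
            · simp [image_eq_zero_of_notMem_tsupport hy]
        _ = r' * ‖v‖ := by rw [← Finset.sum_mul, hsum, one_mul]
    have h4 : |∑ i, (g i y - f y) * mvfderiv 𝓘(ℝ, E) (ρ i) y v| ≤ ε * (∑ i, |C i|) * ‖v‖ :=
      calc |∑ i, (g i y - f y) * mvfderiv 𝓘(ℝ, E) (ρ i) y v|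
          ≤ ∑ i, |(g i y - f y) * mvfderiv 𝓘(ℝ, E) (ρ i) y v| := Finset.abs_sum_le_sum_abs _ _
        _ ≤ ∑ i, ε * (|C i| * ‖v‖) := by
            refine Finset.sum_le_sum fun i _ => ?_
            rw [abs_mul]
            by_cases hy : y ∈ tsupport (ρ i)
            · exact mul_le_mul (hgd i y (hmem i y hy)) (ContinuousLinearMap.le_of_opNorm_le _
                ((hC i y).trans (le_abs_self _)) v) (abs_nonneg _) hε.le
            · rw [hdρ i y hy, zero_apply, abs_zero, mul_zero]
              positivity
        _ = ε * (∑ i, |C i|) * ‖v‖ := by rw [← Finset.mul_sum, ← Finset.sum_mul, mul_assoc]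
    rw [h2, Real.norm_eq_abs]
    calc _ ≤ r' * ‖v‖ + ε * (∑ i, |C i|) * ‖v‖ := (abs_add_le _ _).trans (add_le_add h3 h4)
      _ = (r' + ε * ∑ i, |C i|) * ‖v‖ := by ring
      _ ≤ r * ‖v‖ := mul_le_mul_of_nonneg_right hεr (norm_nonneg _)

end Global

end SymplecticSpinor

end

/-! ### Recovering the geodesic distance from smooth functions. -/

noncomputable section

namespace SymplecticSpinor

section Distance

variable {E : Type*} [NormedAddCommGroup E] [NormedSpace ℝ E]
  {M : Type*} [TopologicalSpace M] [ChartedSpace E M]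
  [RiemannianBundle (fun x : M => TangentSpace 𝓘(ℝ, E) x)]

/-- The triangle inequality. The truncation at `N` keeps the function finite on the other components
of `M`. -/
theorem isGeodesicContraction_min_riemannianEDist (x : M) (N : NNReal) :
    IsGeodesicContraction E
      (fun z : M => (min (riemannianEDist 𝓘(ℝ, E) x z) (N : ℝ≥0∞)).toReal) := by
  have hfin : ∀ z : M, min (riemannianEDist 𝓘(ℝ, E) x z) (N : ℝ≥0∞) ≠ ⊤ := fun z =>
    ne_top_of_le_ne_top ENNReal.coe_ne_top (min_le_right _ _)
  intro z w
  by_cases hd : riemannianEDist 𝓘(ℝ, E) z w = ⊤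
  · rw [hd]; exact le_top
  have key : ∀ z w : M, riemannianEDist 𝓘(ℝ, E) z w ≠ ⊤ →
      (min (riemannianEDist 𝓘(ℝ, E) x z) (N : ℝ≥0∞)).toReal ≤
      (min (riemannianEDist 𝓘(ℝ, E) x w) (N : ℝ≥0∞)).toReal
        + (riemannianEDist 𝓘(ℝ, E) z w).toReal := by
    intro z w hd
    rw [← ENNReal.toReal_add (hfin w) hd]
    refine ENNReal.toReal_mono (ENNReal.add_ne_top.2 ⟨hfin w, hd⟩) ?_
    rw [min_add]
    refine le_min ((min_le_left _ _).trans ?_) ((min_le_right _ _).trans le_self_add)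
    rw [riemannianEDist_comm (x := z)]
    exact riemannianEDist_triangle
  refine ENNReal.ofReal_le_of_le_toReal (abs_sub_le_iff.2 ⟨?_, ?_⟩)
  · linarith [key z w hd]
  · have h := key w z (by rwa [riemannianEDist_comm])
    rw [riemannianEDist_comm (x := w)] at h
    linarith

/-- Smooth functions with differential bounded by `1` detect the geodesic distance. -/
theorem exists_contMDiff_le_abs_sub [IsManifold 𝓘(ℝ, E) ∞ M] [FiniteDimensional ℝ E]
    [T2Space M] [CompactSpace M]
    [IsContMDiffRiemannianBundle 𝓘(ℝ, E) ∞ E (fun x : M => TangentSpace 𝓘(ℝ, E) x)]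
    {x y : M} {c : NNReal} (hc : (c : ℝ≥0∞) < riemannianEDist 𝓘(ℝ, E) x y) :
    ∃ b : M → ℝ, ContMDiff 𝓘(ℝ, E) 𝓘(ℝ, ℝ) ∞ b ∧ (∀ z, ‖mvfderiv 𝓘(ℝ, E) b z‖ ≤ 1) ∧
      (c : ℝ) ≤ |b x - b y| := by
  obtain ⟨N, hcN, hN⟩ := ENNReal.lt_iff_exists_nnreal_btwn.1 hc
  have hcN' : (c : ℝ) < N := by exact_mod_cast hcN
  have hc0 : (0 : ℝ) ≤ c := c.coe_nonneg
  set m : ℝ := (c + N) / 2 with hm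
  -- `c < m` gives both `1 < r` and `c r ≤ m`, also for `c = 0`. The truncated distance goes from
  -- `0` at `x` to `N` at `y`, and two errors of `(N - c) / 4` leave `m`; dividing by `r` leaves at
  -- least `c`.
  set r : ℝ := (m + 1) / (c + 1) with hr
  have hr1 : 1 < r := by rw [hr, lt_div_iff₀ (by positivity)]; linarith
  obtain ⟨a, ha, haf, had⟩ := (isGeodesicContraction_min_riemannianEDist (E := E) x N
    ).exists_contMDiff_approx hr1 (δ := (N - c) / 4) (by linarith)
  have hx := abs_le.1 (haf x)
  have hy := abs_le.1 (haf y)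
  simp only [riemannianEDist_self, zero_le, inf_of_le_left, ENNReal.toReal_zero,
    min_eq_right hN.le, ENNReal.coe_toReal] at hx hy
  refine ⟨fun z => r⁻¹ • a z, (contDiff_const_smul r⁻¹).contMDiff.comp ha, fun z => ?_, ?_⟩
  · refine ContinuousLinearMap.opNorm_le_bound _ zero_le_one fun v => ?_
    have h : mvfderiv 𝓘(ℝ, E) (fun z => r⁻¹ • a z) z v = r⁻¹ * mvfderiv 𝓘(ℝ, E) a z v := by
      have h := mvfderiv_smul (I := 𝓘(ℝ, E)) (mdifferentiableAt_const (c := r⁻¹) (x := z))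
        (ha.mdifferentiable (by simp) z)
      have h' := congrArg (fun l => l v) h
      have h'' : mvfderiv 𝓘(ℝ, E) ((fun _ : M => r⁻¹) • a) z v = r⁻¹ * mvfderiv 𝓘(ℝ, E) a z v := by
        simpa [mvfderiv_const] using h'
      exact h''
    rw [h, norm_mul, Real.norm_of_nonneg (by positivity), one_mul, inv_mul_le_iff₀ (by positivity)]
    exact ContinuousLinearMap.le_of_opNorm_le _ (had z) v
  · have h1 : m ≤ a y - a x := by linarith [hx.2, hy.1]
    have h2 : (c : ℝ) ≤ r⁻¹ * (a y - a x) := by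
      rw [← div_eq_inv_mul, le_div_iff₀ (by positivity)]
      refine le_trans ?_ h1
      rw [hr, mul_div_assoc', div_le_iff₀ (by positivity)]
      nlinarith
    simp only [smul_eq_mul]
    rw [abs_sub_comm, ← mul_sub]
    exact h2.trans (le_abs_self _)

end Distance

end SymplecticSpinor

end

open SymplecticSpinor in
/-- `M` is a compact symplectic manifold of dimension `2n` with a compatible almost complex
structure, whose metric is `g(X, Y) = ω(X, JY)`; `P` is a metaplectic structure and `φ₀` a smooth
section of `Q_0^J` of constant squared fiber norm `2`.

The first part is `‖[D̃, a] φ₀‖² = g⁻¹(da, da)`, the right side being the squared norm of the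
covector `da` dual to `g`. In the second part the commutator needs a domain `𝒞 ⊆ C(M)`: it is any
class of differentiable functions that contains the smooth ones. The geodesic distance is the
infimum of the lengths of `C¹` paths, which is `∞` for points in different components. -/
theorem proposition1 {n : ℕ}
    {E : Type*} [NormedAddCommGroup E] [NormedSpace ℝ E] [FiniteDimensional ℝ E]
    (hE : Module.finrank ℝ E = 2 * n)
    {M : Type*} [TopologicalSpace M] [T2Space M] [CompactSpace M] [ChartedSpace E M]
    [IsManifold 𝓘(ℝ, E) ∞ M]
    [RiemannianBundle (fun x : M => TangentSpace 𝓘(ℝ, E) x)]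
    [IsContMDiffRiemannianBundle 𝓘(ℝ, E) ∞ E (fun x : M => TangentSpace 𝓘(ℝ, E) x)]
    (A : AlmostHermitian E M)
    (cov : CovariantDerivative 𝓘(ℝ, E) E (fun x : M => TangentSpace 𝓘(ℝ, E) x))
    (hcov : A.IsHermitianConnection cov)
    {P : Type*} [TopologicalSpace P] [MulAction (Mp n)ᵐᵒᵖ P]
    (S : MetaplecticStructure n A P)
    (κ : ∀ p : P, S.LocalSection p)
    (u : ∀ x : M, Fin n ⊕ Fin n → TangentSpace 𝓘(ℝ, E) x) (hu : ∀ x, A.IsUnitaryFrame (u x))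
    (φ₀ : P → Schw n) (hφ₀ : S.IsSpinor φ₀) (hQ : S.IsInQ 0 φ₀)
    (hnorm : ∀ p, l2norm (φ₀ p) ^ 2 = 2) :
    (∀ a : C(M, ℝ), MDifferentiable 𝓘(ℝ, E) 𝓘(ℝ, ℝ) a → ∀ p : P,
      l2norm (S.diracComm cov κ u a φ₀ p) ^ 2 = ‖mvfderiv 𝓘(ℝ, E) a (S.proj p)‖ ^ 2) ∧
    (∀ 𝒞 : Set C(M, ℝ),
      (∀ a : C(M, ℝ), ContMDiff 𝓘(ℝ, E) 𝓘(ℝ, ℝ) ∞ a → a ∈ 𝒞) →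
      (∀ a ∈ 𝒞, MDifferentiable 𝓘(ℝ, E) 𝓘(ℝ, ℝ) a) →
      ∀ x y : M, S.spectralDist cov κ u φ₀ 𝒞 x y = riemannianEDist 𝓘(ℝ, E) x y) := by
  have hpart : ∀ a : C(M, ℝ), MDifferentiable 𝓘(ℝ, E) 𝓘(ℝ, ℝ) a → ∀ p : P,
      l2norm (S.diracComm cov κ u a φ₀ p) ^ 2 = ‖mvfderiv 𝓘(ℝ, E) a (S.proj p)‖ ^ 2 :=
    fun a ha p => S.l2norm_diracComm_sq cov hE hφ₀ hQ hnorm κ u hu (ha _)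
  have hle : ∀ a : C(M, ℝ), MDifferentiable 𝓘(ℝ, E) 𝓘(ℝ, ℝ) a → ∀ p : P,
      (l2norm (S.diracComm cov κ u a φ₀ p) ≤ 1 ↔ ‖mvfderiv 𝓘(ℝ, E) a (S.proj p)‖ ≤ 1) := by
    intro a ha p
    have hl : 0 ≤ l2norm (S.diracComm cov κ u a φ₀ p) := norm_nonneg _
    rw [← sq_le_one_iff₀ hl, hpart a ha p,
      sq_le_one_iff₀ (ContinuousLinearMap.opNorm_nonneg _)]
  refine ⟨hpart, fun 𝒞 hsmooth hdiff x y => le_antisymm ?_ ?_⟩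
  · refine iSup₂_le fun a ha => ?_
    refine ofReal_abs_sub_le_riemannianEDist (hdiff a ha.1) (fun z => ?_) x y
    -- The constraint is imposed on `P`; surjectivity of the projection carries it to every point of
    -- `M`.
    obtain ⟨p, rfl⟩ := S.proj_surjective z
    exact (hle a (hdiff a ha.1) p).1 (ha.2 p)
  · refine ENNReal.le_of_forall_nnreal_lt fun c hc => ?_
    obtain ⟨b, hb, hbd, hbc⟩ := exists_contMDiff_le_abs_sub hc
    let b' : C(M, ℝ) := ⟨b, hb.continuous⟩
    have hb' : b' ∈ 𝒞 := hsmooth b' hb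
    refine le_trans ?_ (le_iSup₂_of_le (f := fun (a : C(M, ℝ)) (_ : a ∈ {a : C(M, ℝ) | a ∈ 𝒞 ∧
      ∀ p : P, l2norm (S.diracComm cov κ u a φ₀ p) ≤ 1}) => ENNReal.ofReal |a x - a y|) b'
      ⟨hb', fun p => (hle b' (hdiff b' hb') p).2 (hbd _)⟩ le_rfl)
    rw [← ENNReal.ofReal_coe_nnreal]
    exact ENNReal.ofReal_le_ofReal hbc
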